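/- Let $n\ge 3$ and work over $\mathbb{C}$. Hypersurfaces of degree $n+1$ in $\mathbb{P}^n$ (Calabi--Yau hypersurfaces) are parametrized by the projective space $B$ of nonzero forms of degree $n+1$ in $n+1$ variables up to scalars. For $p,q\in X$ write $p\sim q$ if $p$ and $q$ are rationally equivalent as $0$-cycles on $X$ with integer coefficients, that is, $p-q$ is a finite integer combination of divisors of nonzero rational functions on irreducible curves contained in $X$. (i) A general point of a very general Calabi--Yau hypersurface is rationally equivalent to at least one other point of it: there are countably many proper Zariski closed subsets of $B$ such that every hypersurface $X$ whose parameter lies in none of them has a Zariski dense, Zariski open subset $V\subseteq X$ such that for every $p\in V$ there is a point $q\in X$ with $q\ne p$ and $p\sim q$. (ii) Let $\mathcal{U}\subset\mathbb{P}^n\times B$ be the set of pairs $(p,X)$ with $p\in X$, and let $G\subseteq\mathcal{U}$ be the set of pairs $(p,X)$ such that some point $q\neq p$ of $X$ satisfies $Nq\sim Np$ on $X$ for some nonzero integer $N$. Then $G$ is not contained in any countable union of proper Zariski closed subsets of $\mathcal{U}$. In other words, $G$ has codimension $0$ in $\mathcal{U}$, so the lower bound $-n-1+d$ for the codimension of the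 corresponding locus for degree $d$ hypersurfaces in $\mathbb{P}^n$ cannot be improved when $d=n+1$. -/

import Mathlib

noncomputable section

namespace ChowPoints

/-- Complex projective space with homogeneous coordinates indexed by `σ`. -/
abbrev PSpace (σ : Type) : Type := Projectivization ℂ (σ → ℂ)

/-- A homogeneous polynomial `F` vanishes at the point `p`. (For homogeneous `F` this does not
depend on the representative of `p`.) -/
def VanishesAt {σ : Type} (F : MvPolynomial σ ℂ) (p : PSpace σ) : Prop :=
  MvPolynomial.eval p.rep F = 0

/-- Zariski closed subsets of projective space: common zero loci of homogeneous polynomials. -/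
def IsZariskiClosed {σ : Type} (Z : Set (PSpace σ)) : Prop :=
  ∃ T : Set (MvPolynomial σ ℂ), (∀ F ∈ T, ∃ k : ℕ, F.IsHomogeneous k) ∧
    Z = {p | ∀ F ∈ T, VanishesAt F p}

/-- `F` is bihomogeneous of some bidegree in the two groups of variables `σ` and `τ`. -/
def IsBihomogeneous {σ τ : Type} (F : MvPolynomial (σ ⊕ τ) ℂ) : Prop :=
  ∃ k l : ℕ,
    MvPolynomial.IsWeightedHomogeneous (Sum.elim (fun _ => 1) (fun _ => 0) : σ ⊕ τ → ℕ) F k ∧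
    MvPolynomial.IsWeightedHomogeneous (Sum.elim (fun _ => 0) (fun _ => 1) : σ ⊕ τ → ℕ) F l

/-- Zariski closed subsets of a product of two projective spaces: common zero loci of
bihomogeneous polynomials. -/
def IsZariskiClosedProd {σ τ : Type} (Z : Set (PSpace σ × PSpace τ)) : Prop :=
  ∃ T : Set (MvPolynomial (σ ⊕ τ) ℂ), (∀ F ∈ T, IsBihomogeneous F) ∧
    Z = {x | ∀ F ∈ T, MvPolynomial.eval (Sum.elim x.1.rep x.2.rep) F = 0}

/-! ### Very general and general -/

/-- `P` holds for a very general point of projective space: it holds outside a countable union of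
proper Zariski closed subsets. -/
def ForVeryGeneral {σ : Type} (P : PSpace σ → Prop) : Prop :=
  ∃ Z : ℕ → Set (PSpace σ), (∀ i, IsZariskiClosed (Z i) ∧ Z i ≠ Set.univ) ∧
    ∀ b, (∀ i, b ∉ Z i) → P b

/-- `P` holds for a general point of `X`: it holds at all points of `X \ Z` for some Zariski closed
`Z` such that the relatively open set `X \ Z` is Zariski dense in `X`. -/
def ForGeneralPointOf {σ : Type} (X : Set (PSpace σ)) (P : PSpace σ → Prop) : Prop :=
  ∃ Z : Set (PSpace σ), IsZariskiClosed Z ∧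
    (∀ W : Set (PSpace σ), IsZariskiClosed W → X \ Z ⊆ W → X ⊆ W) ∧
    ∀ p ∈ X \ Z, P p

/-! ### Zero-cycles and rational equivalence -/

/-- The homogeneous prime ideal of the point `p`, that is, the ideal of all polynomials which vanish
on the line `{t • v}` spanned by a representative `v` of `p`. -/
def pointIdeal {σ : Type} (p : PSpace σ) : Ideal (MvPolynomial σ ℂ) :=
  RingHom.ker (MvPolynomial.aeval (fun i => Polynomial.C (p.rep i) * Polynomial.X) :
    MvPolynomial σ ℂ →ₐ[ℂ] Polynomial ℂ)

instance {σ : Type} (p : PSpace σ) : (pointIdeal p).IsPrime :=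
  RingHom.ker_isPrime _

/-- The order of vanishing at `p` of the form `a` on the curve `C` with homogeneous ideal `I`:
with `S` the homogeneous coordinate ring and `P` the homogeneous prime of `p`, it is the length of
the `S_P`-module `(S / (I + (a)))_P`.

`S_P` is obtained from the local ring `O` of projective space at `p` by localizing `O[t, 1/t]` at
the extension of the maximal ideal of `O`, which does not change lengths. So this is the length of
`O_{C,p} / (a / s)`, where `s` is any form of the same degree as `a` with `s(p) ≠ 0`. It is finite
if `C` is a curve and `a ∉ I`, and zero if `p ∉ C` or `a(p) ≠ 0`. -/
def ordAt {σ : Type} (I : Ideal (MvPolynomial σ ℂ)) (a : MvPolynomial σ ℂ) (p : PSpace σ) : ℕ :=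
  (Module.length (Localization.AtPrime (pointIdeal p))
    (Localization.AtPrime (pointIdeal p) ⧸
      (I ⊔ Ideal.span {a}).map
        (algebraMap (MvPolynomial σ ℂ) (Localization.AtPrime (pointIdeal p))))).toNat

/-- `I` is the homogeneous prime ideal of an irreducible projective curve (so that its homogeneous
coordinate ring has Krull dimension two). -/
def IsCurveIdeal {σ : Type} (I : Ideal (MvPolynomial σ ℂ)) : Prop :=
  I.IsPrime ∧ (∀ F ∈ I, ∀ k : ℕ, MvPolynomial.homogeneousComponent k F ∈ I) ∧
    ringKrullDim (MvPolynomial σ ℂ ⧸ I) = 2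

/-- The projective zero locus of a homogeneous ideal. -/
def projZeroLocus {σ : Type} (I : Ideal (MvPolynomial σ ℂ)) : Set (PSpace σ) :=
  {p | ∀ F ∈ I, ∀ k : ℕ, F.IsHomogeneous k → VanishesAt F p}

/-- `D` is the divisor of a nonzero rational function `a / b` on an irreducible curve contained
in `X`. Here `a`, `b` are forms of the same degree not vanishing identically on the curve. -/
def IsPrincipalOn {σ : Type} (X : Set (PSpace σ)) (D : PSpace σ → ℤ) : Prop :=
  ∃ (I : Ideal (MvPolynomial σ ℂ)) (k : ℕ) (a b : MvPolynomial σ ℂ),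
    IsCurveIdeal I ∧ projZeroLocus I ⊆ X ∧
    a.IsHomogeneous k ∧ b.IsHomogeneous k ∧ a ∉ I ∧ b ∉ I ∧
    ∀ p, D p = (ordAt I a p : ℤ) - (ordAt I b p : ℤ)

/-- Rational equivalence of zero-cycles on `X` (finite formal integer combinations of points):
`A - B` is a finite integer combination of divisors of rational functions on irreducible curves
contained in `X`. -/
def RatEquiv {σ : Type} (X : Set (PSpace σ)) (A B : PSpace σ →₀ ℤ) : Prop :=
  ((⇑A - ⇑B : PSpace σ → ℤ)) ∈ AddSubgroup.closure {D : PSpace σ → ℤ | IsPrincipalOn X D}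

/-- The set of points `q` of `X` such that `N q` is rationally equivalent to `N p` on `X` for some
nonzero integer `N`. -/
def ratOrbit {σ : Type} (X : Set (PSpace σ)) (p : PSpace σ) : Set (PSpace σ) :=
  {q | q ∈ X ∧ ∃ N : ℤ, N ≠ 0 ∧ RatEquiv X (Finsupp.single q N) (Finsupp.single p N)}

/-! ### The universal hypersurface -/

/-- The exponents of the monomials of degree `d` in the `n + 1` homogeneous coordinates
of `ℙⁿ`. -/
abbrev Mon (n d : ℕ) : Type :=
  ↥(Finset.finsuppAntidiag (Finset.univ : Finset (Fin (n + 1))) d)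

/-- The form of degree `d` with coefficient vector `c`. -/
def formOf {n d : ℕ} (c : Mon n d → ℂ) : MvPolynomial (Fin (n + 1)) ℂ :=
  ∑ m : Mon n d, MvPolynomial.monomial m.1 (c m)

/-- The hypersurface of degree `d` in `ℙⁿ` with parameter `b`, where the parameter space is the
projective space of nonzero forms of degree `d` up to scalars. -/
def hypersurface {n d : ℕ} (b : PSpace (Mon n d)) : Set (PSpace (Fin (n + 1))) :=
  {p | VanishesAt (formOf b.rep) p}

/-- The universal hypersurface of degree `d` in `ℙⁿ`: pairs `(p, X)` with `p ∈ X`. -/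
def universalHypersurface (n d : ℕ) : Set (PSpace (Fin (n + 1)) × PSpace (Mon n d)) :=
  {x | x.1 ∈ hypersurface x.2}

/-- The locus of pairs `(p, X)` with `p ∈ X` such that some point `q ≠ p` of `X` satisfies
`N q ∼ N p` on `X` for some nonzero integer `N`. -/
def GLocus (n d : ℕ) : Set (PSpace (Fin (n + 1)) × PSpace (Mon n d)) :=
  {x | x ∈ universalHypersurface n d ∧ ratOrbit (hypersurface x.2) x.1 ≠ {x.1}}

/-- The subset `G` of `U` (a subset of a product of projective spaces) has codimension at least one
in `U`, in the sense used for countable unions of subvarieties of an irreducible `U`: it is covered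
by countably many closed subsets none of which contains `U`. -/
def HasPositiveCodim {σ τ : Type} (G U : Set (PSpace σ × PSpace τ)) : Prop :=
  ∃ Z : ℕ → Set (PSpace σ × PSpace τ),
    (∀ i, IsZariskiClosedProd (Z i) ∧ ¬ U ⊆ Z i) ∧ G ⊆ ⋃ i, Z i

end ChowPoints

end

/-! Let `X` be the hypersurface `F = 0` of degree `n + 1`. Suppose a line `L` meets `X` in `p + n
z`, and a second line `L'` through the same contact point `z` meets `X` in `q + n z`. In the plane
spanned by `L` and `L'`, the quotient of the equations of the two lines is a rational function on
each component of the plane section of `X`. Summed over the components with multiplicity, its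
divisors give `(p + n z) - (q + n z) = p - q`, so `p ∼ q`. This is `ratEquiv_of_common_contact`;
independence of the three spanning vectors gives `q ≠ p`.

Such configurations should exist for a general `p`. Pairs `(L, z)` with `p ∈ L` have `n` parameters,
and contact of order `n` at `z` imposes `n` conditions. Given `z ∈ X`, lines through `z` have `n -
1` parameters, and contact of order `n` imposes `n - 1` further conditions, of degrees `1, ..., n -
1`. One thus expects `(n - 1)!` such lines at `z`, more than one when `n ≥ 3`.

The count becomes a proof by a dominance argument. Put `p`, `z` and a point of `L'` at coordinate
points `e_p`, `e_q`, `e_v`; contact then means that certain monomials are absent. Moving `e_q` and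
`e_v` by linear substitutions gives a polynomial family of forms vanishing at `e_p`. Its derivative
is surjective at an explicit form (`exists_famDeriv_eq`), so Chevalley's theorem makes its image
contain a nonempty open set (`exists_generic_linked`). A coordinate change transports this to
arbitrary points: a polynomial `Φ(x, c)`, not identically zero on the incidence `F_c(x) = 0`,
guarantees that `x` is linked (`exists_generic_pair`).

For (ii), the incidence is parametrized by an affine space, and by Baire countably many nonzero
polynomials there have a common point of nonvanishing. For (i), eliminating `x_0` from `Φ` gives a
nonzero polynomial `r` in the other variables (`exists_elimination`). If `F_c` has a nonzero pure
power of `x_0`, then `X` is finite over the remaining coordinates, so a nonzero `r(·, c)` vanishes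
on no component of `X`. -/

noncomputable section

namespace ChowPoints

/-! ### Lengths of localized quotients -/

section LocLength

variable {S : Type*} [CommRing S]

/-- The length of `(S / I)_P` over `S_P`. -/
def locLength (P : Ideal S) [P.IsPrime] (I : Ideal S) : ℕ∞ :=
  Module.length (Localization.AtPrime P)
    (Localization.AtPrime P ⧸ I.map (algebraMap S (Localization.AtPrime P)))

lemma map_localization_eq_top {P : Ideal S} [P.IsPrime] {I : Ideal S} (h : ¬ I ≤ P) :
    I.map (algebraMap S (Localization.AtPrime P)) = ⊤ := by
  obtain ⟨x, hxI, hxP⟩ := Set.not_subset.mp h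
  exact Ideal.eq_top_of_isUnit_mem _ (Ideal.mem_map_of_mem _ hxI)
    (IsLocalization.map_units (Localization.AtPrime P) (⟨x, hxP⟩ : P.primeCompl))

lemma locLength_eq_zero {P : Ideal S} [P.IsPrime] {I : Ideal S} (h : ¬ I ≤ P) :
    locLength P I = 0 := by
  have : Subsingleton (Localization.AtPrime P ⧸
      I.map (algebraMap S (Localization.AtPrime P))) :=
    Ideal.Quotient.subsingleton_iff.mpr (map_localization_eq_top h)
  exact Module.length_eq_zero

lemma locLength_self (P : Ideal S) [P.IsPrime] : locLength P P = 1 := by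
  rw [locLength, Localization.AtPrime.map_eq_maximalIdeal, Module.length_eq_one_iff,
    isSimpleModule_iff_isCoatom]
  exact Ideal.isMaximal_def.mp (IsLocalRing.maximalIdeal.isMaximal _)

/-- Taking the quotient in two stages turns the length into the order of `g` in the local ring of
`J`, where additivity of `Ring.ord` is available. -/
lemma locLength_sup_span (P : Ideal S) [P.IsPrime] (J : Ideal S) (g : S) :
    locLength P (J ⊔ Ideal.span {g}) =
      Ring.ord (Localization.AtPrime P ⧸ J.map (algebraMap S (Localization.AtPrime P)))
        (Ideal.Quotient.mk _ (algebraMap S (Localization.AtPrime P) g)) := by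
  set A := Localization.AtPrime P
  set J' := J.map (algebraMap S A)
  rw [locLength, Ideal.map_sup, Ideal.map_span, Set.image_singleton, Ring.ord,
    ← Module.length_eq_of_surjective (S := A) (R := A ⧸ J') Ideal.Quotient.mk_surjective]
  have e := (DoubleQuot.quotQuotEquivQuotSupₐ A J'
    (Ideal.span {algebraMap S A g})).toLinearEquiv.length_eq
  rw [← e, Ideal.map_span, Set.image_singleton]
  rfl

/-- If `J ≤ P`, then `J` stays prime in the localization and `h` is a non-zero-divisor modulo it, so
orders add. Otherwise all three lengths are zero. -/
lemma locLength_sup_span_mul (P : Ideal S) [P.IsPrime] (J : Ideal S) [J.IsPrime] (g : S) {h : S}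
    (hh : h ∉ J) :
    locLength P (J ⊔ Ideal.span {g * h}) =
      locLength P (J ⊔ Ideal.span {g}) + locLength P (J ⊔ Ideal.span {h}) := by
  by_cases hJ : J ≤ P
  · have hd : Disjoint (P.primeCompl : Set S) (J : Set S) :=
      Set.disjoint_left.mpr fun x hx hxJ => hx (hJ hxJ)
    have hp : (J.map (algebraMap S (Localization.AtPrime P))).IsPrime :=
      IsLocalization.isPrime_of_isPrime_disjoint P.primeCompl _ J inferInstance hd
    have hne : Ideal.Quotient.mk (J.map (algebraMap S (Localization.AtPrime P)))
        (algebraMap S (Localization.AtPrime P) h) ≠ 0 := by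
      rw [Ne, Ideal.Quotient.eq_zero_iff_mem]
      intro hmem
      have := IsLocalization.under_map_of_isPrime_disjoint P.primeCompl
        (Localization.AtPrime P) ‹J.IsPrime› hd
      exact hh (this ▸ (Ideal.mem_comap.mpr hmem))
    rw [locLength_sup_span, locLength_sup_span, locLength_sup_span, map_mul, map_mul,
      Ring.ord_mul _ (mem_nonZeroDivisors_of_ne_zero hne)]
  · have key (x : S) : ¬ J ⊔ Ideal.span {x} ≤ P := fun hx => hJ (le_sup_left.trans hx)
    rw [locLength_eq_zero (key _), locLength_eq_zero (key _), locLength_eq_zero (key _), add_zero]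

lemma locLength_sup_span_of_isUnit (P : Ideal S) [P.IsPrime] (J : Ideal S) {g : S}
    (hg : IsUnit g) : locLength P (J ⊔ Ideal.span {g}) = 0 := by
  refine locLength_eq_zero fun h => ?_
  rw [Ideal.span_singleton_eq_top.mpr hg, sup_top_eq] at h
  exact ‹P.IsPrime›.ne_top (top_le_iff.mp h)

lemma locLength_sup_span_pow (P : Ideal S) [P.IsPrime] (J : Ideal S) [J.IsPrime] {g : S}
    (hg : g ∉ J) (k : ℕ) :
    locLength P (J ⊔ Ideal.span {g ^ k}) = k * locLength P (J ⊔ Ideal.span {g}) := by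
  induction k with
  | zero => rw [pow_zero, locLength_sup_span_of_isUnit P J isUnit_one, Nat.cast_zero, zero_mul]
  | succ k ih =>
    rw [pow_succ, locLength_sup_span_mul P J _ hg, ih]
    push_cast
    ring

lemma sup_span_singleton_congr {J : Ideal S} {g h : S} (hgh : g - h ∈ J) :
    J ⊔ Ideal.span {g} = J ⊔ Ideal.span {h} := by
  apply le_antisymm <;> refine sup_le le_sup_left ((Ideal.span_singleton_le_iff_mem _).mpr ?_)
  · exact Submodule.mem_sup.mpr ⟨g - h, hgh, h, Ideal.mem_span_singleton_self h, by ring⟩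
  · exact Submodule.mem_sup.mpr ⟨-(g - h), J.neg_mem hgh, g, Ideal.mem_span_singleton_self g,
      by ring⟩

end LocLength

/-! ### Krull dimension of plane cones -/

section Dim

open MvPolynomial

/-- The ideals of the plane `x_0 = 0`, of the line `x_0 = x_1 = 0` and of the origin form a chain
above `⊥`; realizing them as kernels of evaluations makes primality immediate. -/
lemma three_le_height_irrelevant :
    3 ≤ (RingHom.ker (constantCoeff : MvPolynomial (Fin 3) ℂ →+* ℂ)).height := by
  let ev (w : Fin 3 → Polynomial (Polynomial ℂ)) :
    MvPolynomial (Fin 3) ℂ →+* Polynomial (Polynomial ℂ) :=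
      (aeval w : MvPolynomial (Fin 3) ℂ →ₐ[ℂ] Polynomial (Polynomial ℂ)).toRingHom
  let p₁ := RingHom.ker (ev ![0, Polynomial.C Polynomial.X, Polynomial.X])
  let p₂ := RingHom.ker (ev ![0, 0, Polynomial.X])
  let p₃ := RingHom.ker (constantCoeff : MvPolynomial (Fin 3) ℂ →+* ℂ)
  have hp₁ : p₁.IsPrime := RingHom.ker_isPrime _
  have hp₂ : p₂.IsPrime := RingHom.ker_isPrime _
  have hp₃ : p₃.IsPrime := RingHom.ker_isPrime _
  have h01 : (⊥ : Ideal (MvPolynomial (Fin 3) ℂ)) < p₁ := by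
    refine bot_lt_iff_ne_bot.mpr fun h => ?_
    have : (X 0 : MvPolynomial (Fin 3) ℂ) ∈ p₁ := by simp [p₁, ev]
    rw [h] at this
    exact X_ne_zero _ this
  have h12 : p₁ < p₂ := by
    refine SetLike.lt_iff_le_and_exists.mpr ⟨fun f hf => ?_, X 1, by simp [p₂, ev],
      by simp [p₁, ev]⟩
    let φ : Polynomial (Polynomial ℂ) →ₐ[ℂ] Polynomial (Polynomial ℂ) :=
      Polynomial.mapAlgHom (Polynomial.CAlgHom.comp (Polynomial.aeval (0 : ℂ)))
    have hc : φ.comp (aeval ![0, Polynomial.C Polynomial.X, Polynomial.X] :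
          MvPolynomial (Fin 3) ℂ →ₐ[ℂ] Polynomial (Polynomial ℂ)) =
        aeval ![0, 0, Polynomial.X] := by
      ext i; fin_cases i <;> simp [φ]
    have hf' : (aeval ![0, Polynomial.C Polynomial.X, Polynomial.X] :
          MvPolynomial (Fin 3) ℂ →ₐ[ℂ] Polynomial (Polynomial ℂ)) f = 0 := hf
    have := DFunLike.congr_fun hc f
    rw [AlgHom.comp_apply, hf', map_zero] at this
    exact this.symm
  have h23 : p₂ < p₃ := by
    refine SetLike.lt_iff_le_and_exists.mpr ⟨fun f hf => ?_, X 2, by simp [p₃],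
      by simp [p₂, ev]⟩
    have hc : ((Polynomial.aeval (0 : ℂ)).comp ((Polynomial.aeval (R := Polynomial ℂ)
        (0 : Polynomial ℂ)).restrictScalars ℂ)).comp
        (aeval ![0, 0, Polynomial.X] :
          MvPolynomial (Fin 3) ℂ →ₐ[ℂ] Polynomial (Polynomial ℂ)) =
        aeval (0 : Fin 3 → ℂ) := by
      ext i; fin_cases i <;> simp
    have hf' : (aeval ![0, 0, Polynomial.X] :
          MvPolynomial (Fin 3) ℂ →ₐ[ℂ] Polynomial (Polynomial ℂ)) f = 0 := hf
    have := DFunLike.congr_fun hc f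
    rw [AlgHom.comp_apply, hf', map_zero, aeval_zero] at this
    exact this.symm
  have k1 := Ideal.height_add_one_le_of_lt_of_isPrime h01
  have k2 := Ideal.height_add_one_le_of_lt_of_isPrime h12
  have k3 := Ideal.height_add_one_le_of_lt_of_isPrime h23
  have : (3 : ℕ∞) = 0 + 1 + 1 + 1 := by norm_num
  rw [this]
  refine le_trans ?_ k3
  gcongr
  refine le_trans ?_ k2
  gcongr
  refine le_trans ?_ k1
  gcongr
  exact zero_le

/-- A nonzero element of a domain lowers the dimension by at least one. Since `f` lies in the
irrelevant ideal, of height at least three, it lowers it by at most one. -/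
lemma ringKrullDim_plane_cone {f : MvPolynomial (Fin 3) ℂ} (hf : f ≠ 0)
    (h0 : constantCoeff f = 0) :
    ringKrullDim (MvPolynomial (Fin 3) ℂ ⧸ Ideal.span {f}) = 2 := by
  have h3 : ringKrullDim (MvPolynomial (Fin 3) ℂ) = 3 := by
    simp [ringKrullDim_eq_zero_of_field]
  have hle := ringKrullDim_quotient_succ_le_of_nonZeroDivisor (mem_nonZeroDivisors_of_ne_zero hf)
  have hp : (RingHom.ker (constantCoeff : MvPolynomial (Fin 3) ℂ →+* ℂ)).IsPrime :=
    RingHom.ker_isPrime _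
  have hge := Ideal.height_le_ringKrullDim_quotient_add_one
    (p := RingHom.ker (constantCoeff : MvPolynomial (Fin 3) ℂ →+* ℂ)) (r := f) h0
  have hge' : (3 : WithBot ℕ∞) ≤ ringKrullDim (MvPolynomial (Fin 3) ℂ ⧸ Ideal.span {f}) + 1 :=
    le_trans (WithBot.coe_le_coe.mpr three_le_height_irrelevant) hge
  rw [h3] at hle
  have h := le_antisymm hle hge'
  generalize ringKrullDim (MvPolynomial (Fin 3) ℂ ⧸ Ideal.span {f}) = x at h
  cases x with
  | bot => exact absurd h (by rintro ⟨⟩)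
  | coe x =>
    have h' : x + 1 = 2 + 1 := WithBot.coe_injective h
    rw [(ENat.add_left_injective_of_ne_top (by simp : (1 : ℕ∞) ≠ ⊤)) h']
    rfl

end Dim

open MvPolynomial

attribute [local instance] MvPolynomial.gradedAlgebra

lemma ringHom_aeval {σ A : Type*} [CommRing A] [Algebra ℂ A] (φ : A →+* ℂ)
    (hφ : ∀ z, φ (algebraMap ℂ A z) = z) (g : σ → A) (F : MvPolynomial σ ℂ) :
    φ (aeval g F) = eval (fun i => φ (g i)) F := by
  rw [map_aeval, show φ.comp (algebraMap ℂ A) = RingHom.id ℂ from RingHom.ext hφ]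
  rfl

lemma eval_aeval {σ τ : Type*} (a : τ → ℂ) (g : σ → MvPolynomial τ ℂ) (F : MvPolynomial σ ℂ) :
    eval a (aeval g F) = eval (fun i => eval a (g i)) F :=
  ringHom_aeval _ (fun z => by simp) g F

lemma polynomial_eval_aeval {σ : Type*} (t : ℂ) (g : σ → Polynomial ℂ) (F : MvPolynomial σ ℂ) :
    Polynomial.eval t (aeval g F) = eval (fun i => Polynomial.eval t (g i)) F :=
  ringHom_aeval (Polynomial.evalRingHom t) (fun z => by simp) g F

/-! ### Prime factors of forms -/

/-- The homogeneous core of `(g)` is prime and contains `f`, hence contains a prime factor of `f`.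
That factor is divisible by `g`, so associated to it, and the core is all of `(g)`. -/
lemma span_singleton_isHomogeneous_of_dvd {σ : Type*} {f g : MvPolynomial σ ℂ} {d : ℕ}
    (hf : f.IsHomogeneous d) (hf0 : f ≠ 0) (hg : Prime g) (hgf : g ∣ f) :
    (Ideal.span {g}).IsHomogeneous (homogeneousSubmodule σ ℂ) := by
  classical
  have hprime : (Ideal.span {g}).IsPrime := (Ideal.span_singleton_prime hg.ne_zero).mpr hg
  set Q := ((Ideal.span {g}).homogeneousCore (homogeneousSubmodule σ ℂ)).toIdeal with hQ
  have hQp : Q.IsPrime := hprime.homogeneousCore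
  have hQle : Q ≤ Ideal.span {g} := Ideal.toIdeal_homogeneousCore_le _ _
  have hfQ : f ∈ Q := Ideal.mem_homogeneousCore_of_homogeneous_of_mem
    ⟨d, hf⟩ (Ideal.mem_span_singleton.mpr hgf)
  have hprod : (UniqueFactorizationMonoid.factors f).prod ∈ Q :=
    (Q.mem_iff_of_associated (UniqueFactorizationMonoid.factors_prod hf0)).mpr hfQ
  obtain ⟨r, hr, hrQ⟩ := (Ideal.IsPrime.multiset_prod_mem_iff_exists_mem hQp _).mp hprod
  have hrp := UniqueFactorizationMonoid.prime_of_factor r hr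
  have hgr : Associated g r := (hg.dvd_prime_iff_associated hrp).mp
    (Ideal.mem_span_singleton.mp (hQle hrQ))
  have hgQ : g ∈ Q := (Q.mem_iff_of_associated hgr).mpr hrQ
  have : Q = Ideal.span {g} :=
    le_antisymm hQle ((Ideal.span_singleton_le_iff_mem _).mpr hgQ)
  rw [← this]
  exact HomogeneousIdeal.isHomogeneous _

lemma constantCoeff_eq_zero_of_span_isHomogeneous {σ : Type*} {g : MvPolynomial σ ℂ}
    (hg : ¬ IsUnit g) (h : (Ideal.span {g}).IsHomogeneous (homogeneousSubmodule σ ℂ)) :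
    constantCoeff g = 0 := by
  by_contra h0
  have := homogeneousComponent_mem_of_mem h (Ideal.mem_span_singleton_self g) 0
  rw [homogeneousComponent_zero, Ideal.mem_span_singleton] at this
  exact hg (isUnit_of_dvd_unit this ((isUnit_iff_ne_zero.mpr h0).map C))

lemma homogeneousComponent_aeval {σ τ : Type*} {g : σ → MvPolynomial τ ℂ}
    (hg : ∀ i, (g i).IsHomogeneous 1) (k : ℕ) (F : MvPolynomial σ ℂ) :
    homogeneousComponent k (aeval g F) = aeval g (homogeneousComponent k F) := by
  have hj (j : ℕ) : (aeval g (homogeneousComponent j F)).IsHomogeneous j := by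
    simpa using (homogeneousComponent_isHomogeneous j F).aeval g hg
  conv_lhs => rw [← sum_homogeneousComponent F]
  rw [map_sum, map_sum, Finset.sum_congr rfl fun j _ => homogeneousComponent_of_mem (hj j)]
  rw [Finset.sum_ite_eq]
  split_ifs with h
  · rfl
  · rw [homogeneousComponent_eq_zero, map_zero]
    simpa [Nat.lt_succ_iff] using h

/-- A polynomial vanishing on a coordinate hyperplane is divisible by the coordinate. -/
lemma X_dvd_of_eval_eq_zero {σ : Type*} {h : MvPolynomial σ ℂ} (j : σ)
    (H : ∀ a : σ → ℂ, a j = 0 → eval a h = 0) : X j ∣ h := by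
  classical
  let u : σ → MvPolynomial σ ℂ := fun i => if i = j then 0 else X i
  have h0 : aeval u h = 0 := by
    refine MvPolynomial.funext fun a => ?_
    rw [eval_aeval, map_zero]
    exact H _ (by simp [u])
  have hc : (Ideal.Quotient.mkₐ ℂ (Ideal.span {(X j : MvPolynomial σ ℂ)})).comp (aeval u) =
      Ideal.Quotient.mkₐ ℂ (Ideal.span {(X j : MvPolynomial σ ℂ)}) := by
    ext i
    by_cases hi : i = j
    · subst hi
      simp only [AlgHom.comp_apply, aeval_X, u, if_true, map_zero]
      exact (Ideal.Quotient.eq_zero_iff_mem.mpr (Ideal.mem_span_singleton_self _)).symm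
    · simp [u, hi]
  have := DFunLike.congr_fun hc h
  rw [AlgHom.comp_apply, h0, map_zero] at this
  exact Ideal.mem_span_singleton.mp (Ideal.Quotient.eq_zero_iff_mem.mp this.symm)

/-! ### Ideals of points -/

lemma mem_pointIdeal_iff {σ : Type} (p : PSpace σ) (F : MvPolynomial σ ℂ) :
    F ∈ pointIdeal p ↔ ∀ t : ℂ, eval (t • p.rep) F = 0 := by
  have key (t : ℂ) : Polynomial.eval t
      (aeval (fun i => Polynomial.C (p.rep i) * Polynomial.X) F) = eval (t • p.rep) F := by
    rw [polynomial_eval_aeval]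
    congr 2
    ext i
    simp only [Polynomial.eval_mul, Polynomial.eval_C, Polynomial.eval_X, Pi.smul_apply,
      smul_eq_mul, mul_comm t]
  rw [pointIdeal, RingHom.mem_ker]
  constructor
  · intro h t
    rw [← key, h, Polynomial.eval_zero]
  · intro h
    refine Polynomial.funext fun t => ?_
    rw [key, h, Polynomial.eval_zero]

lemma mem_pointIdeal_mk_iff {σ : Type} {v : σ → ℂ} (hv : v ≠ 0) (F : MvPolynomial σ ℂ) :
    F ∈ pointIdeal (Projectivization.mk ℂ v hv) ↔ ∀ t : ℂ, eval (t • v) F = 0 := by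
  obtain ⟨a, ha⟩ := Projectivization.exists_smul_eq_mk_rep ℂ v hv
  rw [mem_pointIdeal_iff, ← ha]
  constructor
  · intro h t
    have := h (t * (a⁻¹ : ℂˣ))
    rwa [Units.smul_def, smul_smul, mul_assoc, Units.inv_mul, mul_one] at this
  · intro h t
    rw [Units.smul_def, smul_smul]
    exact h _

lemma eq_of_pointIdeal_le {σ : Type} {p q : PSpace σ} (h : pointIdeal p ≤ pointIdeal q) :
    q = p := by
  have key (i j : σ) : q.rep i * p.rep j = q.rep j * p.rep i := by
    have h1 : X i * C (p.rep j) - X j * C (p.rep i) ∈ pointIdeal p := by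
      rw [mem_pointIdeal_iff]
      intro t
      simp only [map_sub, map_mul, eval_X, eval_C, Pi.smul_apply, smul_eq_mul]
      ring
    have h2 := (mem_pointIdeal_iff q _).mp (h h1) 1
    simpa [sub_eq_zero] using h2
  obtain ⟨j, hj⟩ := Function.ne_iff.mp p.rep_nonzero
  rw [← q.mk_rep, ← p.mk_rep, Projectivization.mk_eq_mk_iff']
  refine ⟨q.rep j / p.rep j, ?_⟩
  ext i
  simp only [Pi.smul_apply, smul_eq_mul]
  rw [div_mul_eq_mul_div, ← key i j, mul_div_cancel_right₀ _ hj]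

open Classical in
lemma locLength_pointIdeal {σ : Type} (p q : PSpace σ) :
    locLength (pointIdeal q) (pointIdeal p) = if q = p then 1 else 0 := by
  split_ifs with h
  · subst h
    exact locLength_self _
  · exact locLength_eq_zero fun hle => h (eq_of_pointIdeal_le hle)

/-- Modulo `K` every coordinate is `v i` times `l`, so the quotient map factors through restriction
to the line spanned by `v`, and what vanishes on that line lies in `K`. -/
lemma eq_pointIdeal_mk {σ : Type} {v : σ → ℂ} (hv : v ≠ 0) {K : Ideal (MvPolynomial σ ℂ)}
    (hK : K ≤ pointIdeal (Projectivization.mk ℂ v hv)) (l : MvPolynomial σ ℂ)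
    (hl : ∀ i, X i - C (v i) * l ∈ K) : K = pointIdeal (Projectivization.mk ℂ v hv) := by
  refine le_antisymm hK fun F hF => ?_
  have h0 : aeval (fun i => Polynomial.C (v i) * Polynomial.X) F = (0 : Polynomial ℂ) := by
    refine Polynomial.funext fun t => ?_
    rw [Polynomial.eval_zero, ← (mem_pointIdeal_mk_iff hv F).mp hF t]
    rw [polynomial_eval_aeval]
    congr 2
    ext i
    simp only [Polynomial.eval_mul, Polynomial.eval_C, Polynomial.eval_X, Pi.smul_apply,
      smul_eq_mul, mul_comm t]
  have hc : ((Ideal.Quotient.mkₐ ℂ K).comp (Polynomial.aeval l)).comp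
      (aeval (fun i => Polynomial.C (v i) * Polynomial.X)) = Ideal.Quotient.mkₐ ℂ K := by
    ext i
    simp only [AlgHom.comp_apply, aeval_X, map_mul, Polynomial.aeval_C, Polynomial.aeval_X]
    rw [← map_mul]
    exact (Ideal.Quotient.eq.mpr (hl i)).symm
  have := DFunLike.congr_fun hc F
  rw [AlgHom.comp_apply, h0, map_zero] at this
  exact Ideal.Quotient.eq_zero_iff_mem.mp this.symm

/-! ### Restriction to a plane -/

section Plane

variable {σ : Type} [Fintype σ]

/-- Restriction of polynomials to the plane spanned by three vectors. -/
def planeMap (w : Fin 3 → σ → ℂ) : MvPolynomial σ ℂ →ₐ[ℂ] MvPolynomial (Fin 3) ℂ :=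
  aeval fun i => ∑ k, C (w k i) * X k

omit [Fintype σ] in
lemma planeMap_X (w : Fin 3 → σ → ℂ) (i : σ) :
    planeMap w (X i) = ∑ k, C (w k i) * X k := aeval_X _ _

omit [Fintype σ] in
lemma isHomogeneous_planeMap_X (w : Fin 3 → σ → ℂ) (i : σ) :
    (∑ k, C (w k i) * X k : MvPolynomial (Fin 3) ℂ).IsHomogeneous 1 :=
  IsHomogeneous.sum _ _ _ fun _ _ => isHomogeneous_C_mul_X _ _

omit [Fintype σ] in
lemma eval_planeMap (w : Fin 3 → σ → ℂ) (a : Fin 3 → ℂ) (F : MvPolynomial σ ℂ) :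
    eval a (planeMap w F) = eval (∑ k, a k • w k) F := by
  rw [planeMap, eval_aeval]
  congr 2
  ext i
  simp [mul_comm]

lemma exists_linear_lift {w : Fin 3 → σ → ℂ} (hw : LinearIndependent ℂ w) (k : Fin 3) :
    ∃ l : MvPolynomial σ ℂ, l.IsHomogeneous 1 ∧ planeMap w l = X k := by
  classical
  obtain ⟨L, hL⟩ := LinearMap.exists_leftInverse_of_injective (Fintype.linearCombination ℂ w)
    (LinearMap.ker_eq_bot.mpr (linearIndependent_iff_injective_fintypeLinearCombination.mp hw))
  refine ⟨∑ i, C (L (Pi.single i 1) k) * X i,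
    IsHomogeneous.sum _ _ _ fun i _ => isHomogeneous_C_mul_X _ _, ?_⟩
  have hLw (j : Fin 3) : ∑ i, w j i * L (Pi.single i 1) k = if j = k then 1 else 0 := by
    have h1 := LinearMap.congr_fun hL (Pi.single j 1)
    rw [LinearMap.comp_apply, Fintype.linearCombination_apply_single, one_smul] at h1
    have h2 : w j = ∑ i, w j i • Pi.single (M := fun _ => ℂ) i (1 : ℂ) :=
      pi_eq_sum_univ' (w j)
    rw [h2, map_sum] at h1
    have h3 := congrFun h1 k
    simpa [Finset.sum_apply, Pi.single_apply, eq_comm] using h3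
  simp only [map_sum, map_mul, planeMap_X, algHom_C, algebraMap_eq, Finset.mul_sum]
  rw [Finset.sum_comm]
  have (j : Fin 3) : ∑ i, C (L (Pi.single i 1) k) * (C (w j i) * X j) =
      C (if j = k then 1 else 0) * (X j : MvPolynomial (Fin 3) ℂ) := by
    rw [← hLw j, map_sum, Finset.sum_mul]
    refine Finset.sum_congr rfl fun i _ => ?_
    rw [C_mul]
    ring
  simp [this]

lemma planeMap_surjective {w : Fin 3 → σ → ℂ} (hw : LinearIndependent ℂ w) :
    Function.Surjective (planeMap w) := by
  choose l hl using exists_linear_lift hw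
  intro h
  refine ⟨aeval l h, ?_⟩
  rw [← AlgHom.comp_apply]
  have : (planeMap w).comp (aeval l) = AlgHom.id ℂ _ := by
    ext1 i
    simp [(hl i).2]
  rw [this]
  rfl

/-- Since `planeMap w` is surjective, the coordinate ring of this curve is that of the plane curve
`g = 0`. -/
lemma isCurveIdeal_comap_planeMap {w : Fin 3 → σ → ℂ} (hw : LinearIndependent ℂ w)
    {g : MvPolynomial (Fin 3) ℂ} (hg : Prime g)
    (hh : (Ideal.span {g}).IsHomogeneous (homogeneousSubmodule (Fin 3) ℂ)) :
    IsCurveIdeal ((Ideal.span {g}).comap (planeMap w)) := by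
  have hprime : (Ideal.span {g}).IsPrime := (Ideal.span_singleton_prime hg.ne_zero).mpr hg
  refine ⟨Ideal.comap_isPrime _ _, fun F hF k => ?_, ?_⟩
  · rw [Ideal.mem_comap] at hF ⊢
    have := homogeneousComponent_mem_of_mem hh hF k
    rwa [planeMap, homogeneousComponent_aeval (isHomogeneous_planeMap_X w)] at this
  · let φ : MvPolynomial σ ℂ →+* MvPolynomial (Fin 3) ℂ ⧸ Ideal.span {g} :=
      (Ideal.Quotient.mk (Ideal.span {g})).comp (planeMap w).toRingHom
    have hφ : Function.Surjective φ :=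
      Ideal.Quotient.mk_surjective.comp (planeMap_surjective hw)
    have hker : (Ideal.span {g}).comap (planeMap w) = RingHom.ker φ := by
      ext F
      exact (Ideal.Quotient.eq_zero_iff_mem (I := Ideal.span {g})).symm
    rw [hker, ringKrullDim_eq_of_ringEquiv (RingHom.quotientKerEquivOfSurjective hφ)]
    exact ringKrullDim_plane_cone hg.ne_zero
      (constantCoeff_eq_zero_of_span_isHomogeneous hg.not_isUnit hh)

end Plane

/-! ### Points linked by two lines with a common contact point -/

lemma ENat.toNat_multiset_sum {α : Type*} (s : Multiset α) (f : α → ℕ∞)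
    (h : (s.map f).sum ≠ ⊤) :
    (((s.map f).sum.toNat : ℕ) : ℤ) = (s.map fun x => ((f x).toNat : ℤ)).sum := by
  induction s using Multiset.induction_on with
  | empty => simp
  | cons a s ih =>
    rw [Multiset.map_cons, Multiset.sum_cons] at h ⊢
    have h1 : f a ≠ ⊤ := fun h' => h (by rw [h', top_add])
    have h2 : (s.map f).sum ≠ ⊤ := fun h' => h (by rw [h', add_top])
    rw [ENat.toNat_add h1 h2, Multiset.map_cons, Multiset.sum_cons, Nat.cast_add, ih h2]

/-! ### Intersection numbers of plane curves, symmetric in the two curves. -/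

section PlaneLength

variable {S R : Type*} [CommRing S] [CommRing R] {π : S →+* R}

/-- The ideal of the intersection of two plane curves. -/
def meetIdeal (π : S →+* R) (y z : R) : Ideal S := (Ideal.span {y} ⊔ Ideal.span {z}).comap π

lemma meetIdeal_comm (y z : R) : meetIdeal π y z = meetIdeal π z y := by
  rw [meetIdeal, meetIdeal, sup_comm]

/-- Together with `meetIdeal_comm`, this exchanges the roles of curve and function: the order of a
linear form on a component of the plane section becomes the order of that component's equation on a
line. -/
lemma comap_span_sup_span (hπ : Function.Surjective π) (y : R) (a : S) :
    (Ideal.span {y}).comap π ⊔ Ideal.span {a} = meetIdeal π y (π a) := by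
  have h : Ideal.span {y} ⊔ Ideal.span {π a} =
      ((Ideal.span {y}).comap π ⊔ Ideal.span {a}).map π := by
    rw [Ideal.map_sup, Ideal.map_comap_of_surjective π hπ, Ideal.map_span, Set.image_singleton]
  rw [meetIdeal, h, Ideal.comap_map_of_surjective π hπ]
  refine (sup_eq_left.mpr ?_).symm
  exact (Ideal.comap_mono bot_le).trans le_sup_left

variable (hπ : Function.Surjective π) (P : Ideal S) [P.IsPrime] {y : R} (hy : Prime y)
include hπ hy

lemma locLength_meetIdeal_mul (g : R) {h : R} (hh : ¬ y ∣ h) :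
    locLength P (meetIdeal π y (g * h)) =
      locLength P (meetIdeal π y g) + locLength P (meetIdeal π y h) := by
  obtain ⟨g, rfl⟩ := hπ g
  obtain ⟨h, rfl⟩ := hπ h
  have hp : (Ideal.span {y}).IsPrime := (Ideal.span_singleton_prime hy.ne_zero).mpr hy
  rw [← map_mul, ← comap_span_sup_span hπ, ← comap_span_sup_span hπ, ← comap_span_sup_span hπ,
    locLength_sup_span_mul]
  rwa [Ideal.mem_comap, Ideal.mem_span_singleton]

lemma locLength_meetIdeal_pow {g : R} (hg : ¬ y ∣ g) (k : ℕ) :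
    locLength P (meetIdeal π y (g ^ k)) = k * locLength P (meetIdeal π y g) := by
  obtain ⟨g, rfl⟩ := hπ g
  have hp : (Ideal.span {y}).IsPrime := (Ideal.span_singleton_prime hy.ne_zero).mpr hy
  rw [← map_pow, ← comap_span_sup_span hπ, ← comap_span_sup_span hπ, locLength_sup_span_pow]
  rwa [Ideal.mem_comap, Ideal.mem_span_singleton]

lemma locLength_meetIdeal_multiset_prod (s : Multiset R) (hs : ∀ g ∈ s, ¬ y ∣ g) :
    locLength P (meetIdeal π y s.prod) = (s.map fun g => locLength P (meetIdeal π y g)).sum := by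
  induction s using Multiset.induction_on with
  | empty =>
    refine locLength_eq_zero fun h => ‹P.IsPrime›.ne_top (top_le_iff.mp ?_)
    simpa [meetIdeal] using h
  | cons a s ih =>
    rw [Multiset.prod_cons, locLength_meetIdeal_mul hπ P hy, Multiset.map_cons, Multiset.sum_cons,
      ih fun g hg => hs g (Multiset.mem_cons_of_mem hg)]
    intro h
    obtain ⟨g, hg, hd⟩ := hy.exists_mem_multiset_dvd h
    exact hs g (Multiset.mem_cons_of_mem hg) hd

omit [P.IsPrime] hy hπ in
lemma meetIdeal_congr {g h : R} (hgh : y ∣ g - h) : meetIdeal π y g = meetIdeal π y h := by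
  rw [meetIdeal, meetIdeal, sup_span_singleton_congr (Ideal.mem_span_singleton.mpr hgh)]

omit [P.IsPrime] hy hπ in
lemma meetIdeal_of_associated [IsDomain R] {g h : R} (hgh : Associated g h) :
    meetIdeal π y g = meetIdeal π y h := by
  rw [meetIdeal, meetIdeal, Ideal.span_singleton_eq_span_singleton.mpr hgh]

end PlaneLength

section Linked

variable {σ : Type} [Fintype σ]

lemma meetIdeal_planeMap_eq_pointIdeal {w : Fin 3 → σ → ℂ} (hw : LinearIndependent ℂ w)
    {y z : MvPolynomial (Fin 3) ℂ} (a : Fin 3 → ℂ) (hv : ∑ k, a k • w k ≠ 0)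
    (hy : ∀ t : ℂ, eval (t • a) y = 0) (hz : ∀ t : ℂ, eval (t • a) z = 0)
    (l : MvPolynomial (Fin 3) ℂ)
    (hl : ∀ k, X k - C (a k) * l ∈ Ideal.span {y} ⊔ Ideal.span {z}) :
    meetIdeal (planeMap w : MvPolynomial σ ℂ →+* MvPolynomial (Fin 3) ℂ) y z =
      pointIdeal (Projectivization.mk ℂ (∑ k, a k • w k) hv) := by
  obtain ⟨l', hl'⟩ := planeMap_surjective hw l
  refine eq_pointIdeal_mk hv (fun F hF => ?_) l' fun i => ?_
  · rw [mem_pointIdeal_mk_iff]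
    intro t
    have h1 : t • ∑ k, a k • w k = ∑ k, (t • a) k • w k := by
      simp [Finset.smul_sum, smul_smul]
    rw [h1, ← eval_planeMap]
    have hle : Ideal.span {y} ⊔ Ideal.span {z} ≤ RingHom.ker (eval (t • a)) :=
      sup_le ((Ideal.span_singleton_le_iff_mem _).mpr (hy t))
        ((Ideal.span_singleton_le_iff_mem _).mpr (hz t))
    exact hle hF
  · rw [meetIdeal, Ideal.mem_comap]
    have h2 : (planeMap w : MvPolynomial σ ℂ →+* MvPolynomial (Fin 3) ℂ)
        (X i - C ((∑ k, a k • w k) i) * l') = ∑ k, C (w k i) * (X k - C (a k) * l) := by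
      simp only [RingHom.coe_coe, map_sub, map_mul, planeMap_X, hl', algHom_C, algebraMap_eq,
        Finset.sum_apply, Pi.smul_apply, smul_eq_mul, map_sum, Finset.sum_mul, mul_sub,
        Finset.sum_sub_distrib]
      congr 1
      refine Finset.sum_congr rfl fun k _ => ?_
      ring
    rw [h2]
    exact Ideal.sum_mem _ fun k _ => Ideal.mul_mem_left _ _ (hl k)

omit [Fintype σ] in
lemma combination_ne_zero {w : Fin 3 → σ → ℂ} (hw : LinearIndependent ℂ w) {a : Fin 3 → ℂ}
    (ha : a ≠ 0) : ∑ k, a k • w k ≠ 0 := fun h =>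
  ha (funext (Fintype.linearIndependent_iff.mp hw a h))

/-- Let `w 0`, `w 1`, `w 2` be independent vectors such that the form `F` restricts to
`c y₀ y₁ᵐ` on the line through `w 0` and `w 1`, and to `y₂ᵐ (α y₀ + β y₂)` on the line through
`w 0` and `w 2`, neither restriction being zero. Then `w 1` is rationally equivalent to
`β w 0 - α w 2` on the hypersurface `F = 0`. -/
theorem ratEquiv_of_common_contact {F : MvPolynomial σ ℂ} {d m : ℕ} (hF : F.IsHomogeneous d)
    {w : Fin 3 → σ → ℂ} (hw : LinearIndependent ℂ w) {c α β : ℂ} (hc : c ≠ 0)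
    (hαβ : ![β, 0, -α] ≠ 0)
    (h1 : ∀ s t : ℂ, eval (s • w 0 + t • w 1) F = c * s * t ^ m)
    (h2 : ∀ s t : ℂ, eval (s • w 0 + t • w 2) F = t ^ m * (α * s + β * t))
    (hp : w 1 ≠ 0) :
    RatEquiv {P | VanishesAt F P} (Finsupp.single (Projectivization.mk ℂ (w 1) hp) 1)
      (Finsupp.single (Projectivization.mk ℂ (∑ k, ![β, 0, -α] k • w k)
        (combination_ne_zero hw hαβ)) 1) := by
  classical
  set π : MvPolynomial σ ℂ →+* MvPolynomial (Fin 3) ℂ := RingHomClass.toRingHom (planeMap w) with hπdef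
  have hπ : Function.Surjective π := planeMap_surjective hw
  set f := π F with hf
  set l : MvPolynomial (Fin 3) ℂ := C α * X 0 + C β * X 2 with hl
  have hX (i : Fin 3) : Prime (X i : MvPolynomial (Fin 3) ℂ) := X_prime
  have hev (a : Fin 3 → ℂ) : eval a f = eval (a 0 • w 0 + a 1 • w 1 + a 2 • w 2) F := by
    rw [hf, hπdef, RingHom.coe_coe, eval_planeMap, Fin.sum_univ_three]
  -- On the lines `X 2 = 0` and `X 1 = 0`, `f` becomes the prescribed product of linear forms.
  have hd2 : (X 2 : MvPolynomial (Fin 3) ℂ) ∣ f - C c * (X 0 * X 1 ^ m) := by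
    refine X_dvd_of_eval_eq_zero 2 fun a ha => ?_
    rw [map_sub, hev, ha, zero_smul, add_zero, h1]
    simp [mul_assoc]
  have hd1 : (X 1 : MvPolynomial (Fin 3) ℂ) ∣ f - l * X 2 ^ m := by
    refine X_dvd_of_eval_eq_zero 1 fun a ha => ?_
    rw [map_sub, hev, ha, zero_smul, add_zero, h2]
    simp [hl, mul_comm]
  have hXX {i j : Fin 3} (hij : i ≠ j) : ¬ (X i : MvPolynomial (Fin 3) ℂ) ∣ X j := by
    rw [X_dvd_X]
    tauto
  have hXp {i j : Fin 3} (hij : i ≠ j) : ¬ (X i : MvPolynomial (Fin 3) ℂ) ∣ X j ^ m :=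
    fun h => hXX hij ((hX i).dvd_of_dvd_pow h)
  have hl1 : ¬ (X 1 : MvPolynomial (Fin 3) ℂ) ∣ l := by
    rintro ⟨g, hg⟩
    apply hαβ
    have e0 := congrArg (eval ![1, 0, 0]) hg
    have e2 := congrArg (eval ![0, 0, 1]) hg
    simp [hl] at e0 e2
    simp [e0, e2]
  have hf2 : ¬ (X 2 : MvPolynomial (Fin 3) ℂ) ∣ f := fun h => by
    have := (dvd_sub_right h).mp hd2
    rw [(hX 2).dvd_mul, (hX 2).dvd_mul] at this
    rcases this with h | h | h
    · exact (hX 2).not_isUnit (isUnit_of_dvd_unit h ((isUnit_iff_ne_zero.mpr hc).map C))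
    · exact hXX (by decide) h
    · exact hXp (by decide) h
  have hf1 : ¬ (X 1 : MvPolynomial (Fin 3) ℂ) ∣ f := fun h => by
    have := (dvd_sub_right h).mp hd1
    rw [(hX 1).dvd_mul] at this
    rcases this with h | h
    · exact hl1 h
    · exact hXp (by decide) h
  have hf0 : f ≠ 0 := fun h => hf1 (h ▸ dvd_zero _)
  have hfh : f.IsHomogeneous d := by
    have := hF.aeval (fun i => ∑ k, C (w k i) * X k) (isHomogeneous_planeMap_X w)
    rwa [one_mul] at this
  -- the prime factors
  set s := UniqueFactorizationMonoid.factors f with hs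
  have hsp : Associated s.prod f := UniqueFactorizationMonoid.factors_prod hf0
  have hsprime (g) (hg : g ∈ s) : Prime g := UniqueFactorizationMonoid.prime_of_factor g hg
  have hsdvd (g) (hg : g ∈ s) : g ∣ f := UniqueFactorizationMonoid.dvd_of_mem_factors hg
  have hsX (i : Fin 3) (hi : ¬ X i ∣ f) (g) (hg : g ∈ s) : ¬ X i ∣ g :=
    fun h => hi (h.trans (hsdvd g hg))
  have hsX' (i : Fin 3) (hi : ¬ X i ∣ f) (g) (hg : g ∈ s) : ¬ g ∣ X i := fun h =>
    hsX i hi g hg ((hsprime g hg).dvd_prime_iff_associated (hX i) |>.mp h).symm.dvd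
  obtain ⟨l₁, hl₁, hl₁'⟩ := exists_linear_lift hw 1
  obtain ⟨l₂, hl₂, hl₂'⟩ := exists_linear_lift hw 2
  replace hl₁' : π l₁ = X 1 := hl₁'
  replace hl₂' : π l₂ = X 2 := hl₂'
  -- intersection numbers
  have hpt0 : meetIdeal π (X 2) (X 1) = pointIdeal (Projectivization.mk ℂ _
      (combination_ne_zero hw (a := ![1, 0, 0]) (by simp))) := by
    refine meetIdeal_planeMap_eq_pointIdeal hw _ _ (by simp) (by simp) (X 0) fun k => ?_
    fin_cases k
    · simp
    · simpa using Ideal.mem_sup_right (Ideal.mem_span_singleton_self _)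
    · simpa using Ideal.mem_sup_left (Ideal.mem_span_singleton_self _)
  have hpt1 : meetIdeal π (X 2) (X 0) = pointIdeal (Projectivization.mk ℂ _
      (combination_ne_zero hw (a := ![0, 1, 0]) (by simp))) := by
    refine meetIdeal_planeMap_eq_pointIdeal hw _ _ (by simp) (by simp) (X 1) fun k => ?_
    fin_cases k
    · simpa using Ideal.mem_sup_right (Ideal.mem_span_singleton_self _)
    · simp
    · simpa using Ideal.mem_sup_left (Ideal.mem_span_singleton_self _)
  have hpt2 : meetIdeal π (X 1) l = pointIdeal (Projectivization.mk ℂ _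
      (combination_ne_zero hw hαβ)) := by
    have hm1 : (X 1 : MvPolynomial (Fin 3) ℂ) ∈ Ideal.span {X 1} ⊔ Ideal.span {l} :=
      Ideal.mem_sup_left (Ideal.mem_span_singleton_self _)
    have hml : l ∈ Ideal.span {(X 1 : MvPolynomial (Fin 3) ℂ)} ⊔ Ideal.span {l} :=
      Ideal.mem_sup_right (Ideal.mem_span_singleton_self _)
    -- The auxiliary form must take the value one at `(β, 0, -α)`, so it is built from a coordinate
    -- that does not vanish there.
    by_cases hβ : β = 0
    · have hα : α ≠ 0 := fun h => hαβ (by simp [h, hβ])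
      have hCC : C α⁻¹ * C α = (1 : MvPolynomial (Fin 3) ℂ) := by
        rw [← C_mul, inv_mul_cancel₀ hα, C_1]
      refine meetIdeal_planeMap_eq_pointIdeal hw _ _ (by simp) (by simp [hl, hβ])
        (-C α⁻¹ * X 2) fun k => ?_
      fin_cases k
      · have : (X 0 : MvPolynomial (Fin 3) ℂ) = C α⁻¹ * l := by
          rw [hl, hβ, C_0, zero_mul, add_zero, ← mul_assoc, hCC, one_mul]
        simpa [hβ, ← this] using Ideal.mul_mem_left _ (C α⁻¹) hml
      · simpa using hm1
      · simp [← mul_assoc, mul_comm (C α), hCC]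
    · have hCC : C β⁻¹ * C β = (1 : MvPolynomial (Fin 3) ℂ) := by
        rw [← C_mul, inv_mul_cancel₀ hβ, C_1]
      refine meetIdeal_planeMap_eq_pointIdeal hw _ _ (by simp) (fun t => ?_)
        (C β⁻¹ * X 0) fun k => ?_
      · simp [hl]; ring
      · fin_cases k
        · have : (X 0 : MvPolynomial (Fin 3) ℂ) - C β * (C β⁻¹ * X 0) = 0 := by
            rw [← mul_assoc, mul_comm (C β), hCC, one_mul, sub_self]
          simpa only [Fin.zero_eta, Matrix.cons_val_zero, this] using Ideal.zero_mem _
        · simpa using hm1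
        · have : (X 2 : MvPolynomial (Fin 3) ℂ) + C α * (C β⁻¹ * X 0) = C β⁻¹ * l := by
            rw [hl, mul_add, ← mul_assoc (C β⁻¹) (C β), hCC]; ring
          simpa [this] using Ideal.mul_mem_left _ (C β⁻¹) hml
  -- After swapping curve and line, additivity on the line `X 2 = 0` collapses the sum over
  -- components to the order of `f` on that line, which is `w 1` plus `m` times `w 0`.
  have hsum2 (P : PSpace σ) :
      (s.map fun g => locLength (pointIdeal P) (meetIdeal π g (X 2))).sum =
        locLength (pointIdeal P) (meetIdeal π (X 2) (X 0)) +
          m * locLength (pointIdeal P) (meetIdeal π (X 2) (X 1)) := by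
    simp_rw [fun g => meetIdeal_comm (π := π) g (X 2)]
    rw [← locLength_meetIdeal_multiset_prod hπ _ (hX 2) s (hsX 2 hf2),
      meetIdeal_of_associated hsp, meetIdeal_congr hd2,
      meetIdeal_of_associated (associated_unit_mul_left _ _ ((isUnit_iff_ne_zero.mpr hc).map C)),
      locLength_meetIdeal_mul hπ _ (hX 2) _ (hXp (by decide)),
      locLength_meetIdeal_pow hπ _ (hX 2) (hXX (by decide))]
  have hsum1 (P : PSpace σ) :
      (s.map fun g => locLength (pointIdeal P) (meetIdeal π g (X 1))).sum =
        locLength (pointIdeal P) (meetIdeal π (X 1) l) +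
          m * locLength (pointIdeal P) (meetIdeal π (X 2) (X 1)) := by
    simp_rw [fun g => meetIdeal_comm (π := π) g (X 1)]
    rw [← locLength_meetIdeal_multiset_prod hπ _ (hX 1) s (hsX 1 hf1),
      meetIdeal_of_associated hsp, meetIdeal_congr hd1,
      locLength_meetIdeal_mul hπ _ (hX 1) _ (hXp (by decide)),
      locLength_meetIdeal_pow hπ _ (hX 1) (hXX (by decide)),
      meetIdeal_comm (π := π) (X 1) (X 2)]
  -- the divisor
  let D (g : MvPolynomial (Fin 3) ℂ) : PSpace σ → ℤ := fun P =>
    (ordAt ((Ideal.span {g}).comap π) l₂ P : ℤ) - ordAt ((Ideal.span {g}).comap π) l₁ P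
  have hD (g) (hg : g ∈ s) : D g ∈
      AddSubgroup.closure {D : PSpace σ → ℤ | IsPrincipalOn {P | VanishesAt F P} D} := by
    refine AddSubgroup.subset_closure ⟨_, 1, l₂, l₁, isCurveIdeal_comap_planeMap hw (hsprime g hg)
      (span_singleton_isHomogeneous_of_dvd hfh hf0 (hsprime g hg) (hsdvd g hg)),
      fun P hP => ?_, hl₂, hl₁, ?_, ?_, fun P => rfl⟩
    · exact hP F (Ideal.mem_span_singleton.mpr (hsdvd g hg)) d hF
    · intro h
      have h' : π l₂ ∈ Ideal.span {g} := h
      rw [hl₂', Ideal.mem_span_singleton] at h'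
      exact hsX' 2 hf2 g hg h'
    · intro h
      have h' : π l₁ ∈ Ideal.span {g} := h
      rw [hl₁', Ideal.mem_span_singleton] at h'
      exact hsX' 1 hf1 g hg h'
  rw [RatEquiv]
  have hDP : (s.map D).sum = ⇑(Finsupp.single (Projectivization.mk ℂ (w 1) hp) (1 : ℤ)) -
      ⇑(Finsupp.single (Projectivization.mk ℂ (∑ k, ![β, 0, -α] k • w k)
        (combination_ne_zero hw hαβ)) (1 : ℤ)) := by
    ext P
    have e1 : (s.map D).sum P = (s.map fun g => D g P).sum := by
      have := map_multiset_sum (Pi.evalAddMonoidHom (fun _ : PSpace σ => ℤ) P) (s.map D)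
      rw [Multiset.map_map] at this
      exact this
    have e2 (g : MvPolynomial (Fin 3) ℂ) : D g P =
        ((locLength (pointIdeal P) (meetIdeal π g (X 2))).toNat : ℤ) -
          (locLength (pointIdeal P) (meetIdeal π g (X 1))).toNat := by
      rw [← hl₂', ← hl₁', ← comap_span_sup_span hπ, ← comap_span_sup_span hπ]
      rfl
    -- `ordAt` sends infinite length to zero, so finiteness must be known before the natural-number
    -- orders can be added.
    have hm (x y z : PSpace σ) : (if P = x then (1 : ℕ∞) else 0) + m * (if P = y then 1 else 0) ≠ ⊤ ∧
        ((if P = x then (1 : ℕ∞) else 0) + m * (if P = y then 1 else 0)).toNat =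
          (if P = x then 1 else 0) + m * (if P = y then 1 else 0) := by
      constructor
      · split_ifs <;> simp
      · split_ifs <;> simp
    have hp1 : Projectivization.mk ℂ _ (combination_ne_zero hw (a := ![0, 1, 0]) (by simp)) =
        Projectivization.mk ℂ (w 1) hp := by
      congr 1
      simp [Fin.sum_univ_three]
    rw [e1, Multiset.map_congr rfl fun g _ => e2 g, Multiset.sum_map_sub,
      ← ENat.toNat_multiset_sum, ← ENat.toNat_multiset_sum, hsum2, hsum1, hpt0, hpt1, hpt2, hp1]
    · simp only [locLength_pointIdeal]
      rw [(hm _ _ P).2, (hm _ _ P).2]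
      simp only [Pi.sub_apply, Finsupp.single_apply, eq_comm (b := P)]
      push_cast
      ring
    · rw [hsum1, hpt2, hpt0]
      simp only [locLength_pointIdeal]
      exact (hm _ _ P).1
    · rw [hsum2, hpt1, hpt0]
      simp only [locLength_pointIdeal]
      exact (hm _ _ P).1
  rw [← hDP]
  refine AddSubgroup.multiset_sum_mem _ _ fun x hx => ?_
  obtain ⟨g, hg, rfl⟩ := Multiset.mem_map.mp hx
  exact hD g hg

end Linked

/-! ### Polynomial maps with surjective derivative -/

section Dominant

/-- A constructible set or its complement contains a neighbourhood of the generic point, according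
to which of them contains that point. Both cases are carried through the induction so that it passes
to complements. -/
lemma exists_basicOpen_of_isConstructible {A : Type*} [CommRing A] [IsDomain A]
    {s : Set (PrimeSpectrum A)} (hs : Topology.IsConstructible s) (h : (⊥ : PrimeSpectrum A) ∈ s) :
    ∃ φ : A, φ ≠ 0 ∧ (PrimeSpectrum.basicOpen φ : Set (PrimeSpectrum A)) ⊆ s := by
  suffices H : ((⊥ : PrimeSpectrum A) ∈ s → ∃ φ : A, φ ≠ 0 ∧
      (PrimeSpectrum.basicOpen φ : Set (PrimeSpectrum A)) ⊆ s) ∧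
      ((⊥ : PrimeSpectrum A) ∉ s → ∃ φ : A, φ ≠ 0 ∧
      (PrimeSpectrum.basicOpen φ : Set (PrimeSpectrum A)) ⊆ sᶜ) from H.1 h
  clear h
  induction hs using Topology.IsConstructible.empty_union_induction with
  | open_retrocompact U hU _ =>
    constructor
    · intro h
      obtain ⟨_, ⟨φ, rfl⟩, hφ, hφU⟩ :=
        PrimeSpectrum.isTopologicalBasis_basic_opens.exists_subset_of_mem_open h hU
      refine ⟨φ, fun h0 => ?_, hφU⟩
      simp [h0] at hφ
    · intro h
      refine ⟨1, one_ne_zero, fun x _ hxU => h ?_⟩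
      exact (PrimeSpectrum.le_iff_specializes _ _).mp (bot_le : ⊥ ≤ x) |>.mem_open hU hxU
  | union s hs t ht ihs iht =>
    constructor
    · rintro (h | h)
      · obtain ⟨φ, h0, hφ⟩ := ihs.1 h
        exact ⟨φ, h0, hφ.trans Set.subset_union_left⟩
      · obtain ⟨φ, h0, hφ⟩ := iht.1 h
        exact ⟨φ, h0, hφ.trans Set.subset_union_right⟩
    · intro h
      obtain ⟨φ, h0, hφ⟩ := ihs.2 fun h' => h (Or.inl h')
      obtain ⟨ψ, h0', hψ⟩ := iht.2 fun h' => h (Or.inr h')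
      refine ⟨φ * ψ, mul_ne_zero h0 h0', ?_⟩
      rw [PrimeSpectrum.basicOpen_mul, Set.compl_union]
      exact Set.inter_subset_inter hφ hψ
  | compl s hs ih => exact ⟨fun h => ih.2 h, fun h => by simpa using ih.1 (by simpa using h)⟩

variable {κ κ' : Type} [Fintype κ] [Fintype κ']

/-- The value of `P` at `a + u ε`. -/
def dualEval (a u : κ → ℂ) : MvPolynomial κ ℂ →ₐ[ℂ] DualNumber ℂ :=
  aeval fun i => TrivSqZeroExt.inl (a i) + TrivSqZeroExt.inr (u i)

omit [Fintype κ] in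
lemma fst_dualEval (a u : κ → ℂ) (P : MvPolynomial κ ℂ) : (dualEval a u P).fst = eval a P := by
  refine (ringHom_aeval (TrivSqZeroExt.fstHom ℂ ℂ ℂ : DualNumber ℂ →+* ℂ) (fun z => ?_) _ P).trans
    ?_
  · exact AlgHom.commutes (TrivSqZeroExt.fstHom ℂ ℂ ℂ) z
  · simp

lemma exists_hasStrictFDerivAt_eval (a : κ → ℂ) (P : MvPolynomial κ ℂ) :
    ∃ L : (κ → ℂ) →L[ℂ] ℂ, HasStrictFDerivAt (fun x => eval x P) L a ∧
      ∀ u, L u = (dualEval a u P).snd := by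
  induction P using MvPolynomial.induction_on with
  | C z =>
    refine ⟨0, by simpa using hasStrictFDerivAt_const z a, fun u => ?_⟩
    simp [dualEval, TrivSqZeroExt.algebraMap_eq_inl]
  | add p q hp hq =>
    obtain ⟨L, hL, hL'⟩ := hp
    obtain ⟨M, hM, hM'⟩ := hq
    refine ⟨L + M, by simp only [map_add]; exact hL.add hM, fun u => ?_⟩
    simp [hL', hM']
  | mul_X p i hp =>
    obtain ⟨L, hL, hL'⟩ := hp
    refine ⟨_, by simp only [map_mul, eval_X]; exact hL.mul (hasStrictFDerivAt_apply i a),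
      fun u => ?_⟩
    simp only [map_mul, TrivSqZeroExt.snd_mul, fst_dualEval, ← hL']
    simp [dualEval, mul_comm]

omit [Fintype κ'] in
/-- A polynomial vanishing near a point is zero. -/
lemma eq_zero_of_eventually_eval_eq_zero {P : MvPolynomial κ' ℂ} {c : κ' → ℂ}
    (h : ∀ᶠ x in nhds c, eval x P = 0) : P = 0 := by
  rw [nhds_pi, Filter.eventually_iff, Filter.mem_pi'] at h
  obtain ⟨I, t, ht, hsub⟩ := h
  refine MvPolynomial.funext_set t (fun i => ?_) fun x hx => ?_
  · exact infinite_of_mem_nhds (c i) (ht i)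
  · rw [map_zero]
    exact hsub fun i _ => hx i trivial

/-- By the open mapping property of submersions, the image of `Ψ` contains a classical
neighbourhood, and a polynomial vanishing there is zero. -/
lemma aeval_injective_of_surjective_derivative (Ψ : κ' → MvPolynomial κ ℂ) (a : κ → ℂ)
    (hsurj : ∀ t : κ' → ℂ, ∃ u : κ → ℂ, ∀ k, (dualEval a u (Ψ k)).snd = t k) :
    Function.Injective (aeval Ψ : MvPolynomial κ' ℂ →ₐ[ℂ] MvPolynomial κ ℂ) := by
  choose L hL hL' using fun k => exists_hasStrictFDerivAt_eval a (Ψ k)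
  have hd : HasStrictFDerivAt (fun x k => eval x (Ψ k)) (ContinuousLinearMap.pi L) a :=
    hasStrictFDerivAt_pi.mpr hL
  have hrange : (ContinuousLinearMap.pi L).range = ⊤ := by
    refine LinearMap.range_eq_top.mpr fun t => ?_
    obtain ⟨u, hu⟩ := hsurj t
    refine ⟨u, funext fun k => ?_⟩
    rw [← hu k, ← hL' k u]
    rfl
  have hmap := hd.map_nhds_eq_of_surj hrange
  refine (injective_iff_map_eq_zero _).mpr fun P hP => ?_
  refine eq_zero_of_eventually_eval_eq_zero (c := fun k => eval a (Ψ k)) ?_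
  rw [← hmap, Filter.eventually_map]
  refine Filter.Eventually.of_forall fun x => ?_
  rw [← eval_aeval, hP, map_zero]

/-- The image of a polynomial map whose derivative is surjective at some point contains a nonempty
Zariski open set, even after removing a hypersurface from the source. -/
theorem exists_ne_zero_forall_mem_range (Ψ : κ' → MvPolynomial κ ℂ) (a : κ → ℂ)
    (hsurj : ∀ t : κ' → ℂ, ∃ u : κ → ℂ, ∀ k, (dualEval a u (Ψ k)).snd = t k)
    {h : MvPolynomial κ ℂ} (hh : h ≠ 0) :
    ∃ φ : MvPolynomial κ' ℂ, φ ≠ 0 ∧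
      ∀ c, eval c φ ≠ 0 → ∃ x, eval x h ≠ 0 ∧ ∀ k, eval x (Ψ k) = c k := by
  have hinj := aeval_injective_of_surjective_derivative Ψ a hsurj
  set f : MvPolynomial κ' ℂ →+* MvPolynomial κ ℂ := (aeval Ψ).toRingHom with hf
  have hfp : f.FinitePresentation := by
    rw [← RingHom.FinitePresentation.of_finiteType]
    refine RingHom.FiniteType.of_comp_finiteType (f := (C : ℂ →+* MvPolynomial κ' ℂ)) ?_
    have : f.comp C = (C : ℂ →+* MvPolynomial κ ℂ) := by ext; simp [hf]
    rw [this]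
    exact RingHom.finiteType_algebraMap.mpr (inferInstance : Algebra.FiniteType ℂ (MvPolynomial κ ℂ))
  have hcon := PrimeSpectrum.isConstructible_comap_image hfp
    (PrimeSpectrum.isConstructible_basicOpen (f := h))
  obtain ⟨φ, hφ, hsub⟩ := exists_basicOpen_of_isConstructible hcon
    ⟨⊥, by simpa using hh, PrimeSpectrum.ext (by
      rw [PrimeSpectrum.comap_asIdeal]
      exact (RingHom.ker_eq_comap_bot f).symm.trans
        ((RingHom.injective_iff_ker_eq_bot f).mp hinj))⟩
  -- Chevalley's theorem only gives a prime `Q` over the closed point `c` with `h ∉ Q`. The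
  -- Nullstellensatz then supplies a closed point of `Q` at which `h` is nonzero.
  refine ⟨φ, hφ, fun c hc => ?_⟩
  obtain ⟨Q, hQh, hQ⟩ := hsub (show (⟨RingHom.ker (eval c), RingHom.ker_isPrime _⟩ :
    PrimeSpectrum (MvPolynomial κ' ℂ)) ∈ PrimeSpectrum.basicOpen φ from hc)
  have hQp := Q.isPrime
  have hx : ∃ x ∈ zeroLocus ℂ Q.asIdeal, eval x h ≠ 0 := by
    by_contra! hcon
    have : h ∈ vanishingIdeal ℂ (zeroLocus ℂ Q.asIdeal) := fun x hx => hcon x hx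
    rw [MvPolynomial.IsPrime.vanishingIdeal_zeroLocus] at this
    exact hQh this
  obtain ⟨x, hx, hxh⟩ := hx
  refine ⟨x, hxh, fun k => ?_⟩
  have hmem : X k - C (c k) ∈ Q.asIdeal.comap f := by
    have := congrArg PrimeSpectrum.asIdeal hQ
    rw [PrimeSpectrum.comap_asIdeal] at this
    rw [this]
    simp [RingHom.mem_ker]
  have := hx _ hmem
  simpa [hf, sub_eq_zero] using this

end Dominant

/-- Countably many nonzero polynomials have a common point of nonvanishing. -/
lemma exists_forall_eval_ne_zero {κ : Type} [Fintype κ] (P : ℕ → MvPolynomial κ ℂ)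
    (hP : ∀ i, P i ≠ 0) : ∃ x : κ → ℂ, ∀ i, eval x (P i) ≠ 0 := by
  -- Nonvanishing loci are open and dense in the classical topology, so Baire's theorem applies.
  have hd : Dense (⋂ i, {x : κ → ℂ | eval x (P i) ≠ 0}) := by
    refine dense_iInter_of_isOpen (fun i => ?_) fun i => ?_
    · exact isOpen_compl_singleton.preimage (MvPolynomial.continuous_eval (P i))
    · rw [dense_iff_inter_open]
      rintro U hU ⟨c, hc⟩
      by_contra hne
      refine hP i (eq_zero_of_eventually_eval_eq_zero (c := c) ?_)
      filter_upwards [hU.mem_nhds hc] with x hx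
      by_contra h0
      exact hne ⟨x, hx, h0⟩
  obtain ⟨x, hx⟩ := hd.nonempty
  exact ⟨x, fun i => Set.mem_iInter.mp hx i⟩

/-! ### Linked points -/

section Linked

variable {σ : Type} [Fintype σ]

/-- The vectors `w 0`, `w 1`, `w 2` span two lines with a common contact point of order `m`. -/
structure IsContactFrame (m : ℕ) (F : MvPolynomial σ ℂ) (w : Fin 3 → σ → ℂ) (c α β : ℂ) :
    Prop where
  indep : LinearIndependent ℂ w
  ne_zero : c ≠ 0
  vec_ne_zero : ![β, 0, -α] ≠ 0
  eval_fst : ∀ s t : ℂ, eval (s • w 0 + t • w 1) F = c * s * t ^ m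
  eval_snd : ∀ s t : ℂ, eval (s • w 0 + t • w 2) F = t ^ m * (α * s + β * t)

/-- The vector `p` spans a line through a contact point shared with another line. -/
def IsLinked (m : ℕ) (F : MvPolynomial σ ℂ) (p : σ → ℂ) : Prop :=
  ∃ (w : Fin 3 → σ → ℂ) (c α β : ℂ), w 1 = p ∧ IsContactFrame m F w c α β

omit [Fintype σ] in
lemma IsLinked.ne_zero {m : ℕ} {F : MvPolynomial σ ℂ} {p : σ → ℂ} (h : IsLinked m F p) :
    p ≠ 0 := by
  obtain ⟨w, c, α, β, rfl, h⟩ := h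
  exact h.indep.ne_zero 1

omit [Fintype σ] in
lemma IsLinked.of_map {m : ℕ} {F F' : MvPolynomial σ ℂ} (T : (σ → ℂ) →ₗ[ℂ] (σ → ℂ))
    (hT : ∀ x, eval x F' = eval (T x) F) {w : Fin 3 → σ → ℂ} {c α β : ℂ}
    (h : IsContactFrame m F (fun k => T (w k)) c α β) : IsLinked m F' (w 1) := by
  refine ⟨w, c, α, β, rfl, LinearIndependent.of_comp T h.indep, h.ne_zero, h.vec_ne_zero,
    fun s t => ?_, fun s t => ?_⟩
  · rw [hT, map_add, map_smul, map_smul]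
    exact h.eval_fst s t
  · rw [hT, map_add, map_smul, map_smul]
    exact h.eval_snd s t

theorem IsLinked.exists_ratEquiv {m d : ℕ} {F : MvPolynomial σ ℂ} (hF : F.IsHomogeneous d)
    {p : σ → ℂ} (h : IsLinked m F p) :
    ∃ q ∈ {P : PSpace σ | VanishesAt F P}, q ≠ Projectivization.mk ℂ p h.ne_zero ∧
      RatEquiv {P | VanishesAt F P} (Finsupp.single (Projectivization.mk ℂ p h.ne_zero) 1)
        (Finsupp.single q 1) := by
  have hp := h.ne_zero
  obtain ⟨w, c, α, β, rfl, h⟩ := h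
  refine ⟨_, ?_, ?_, ratEquiv_of_common_contact hF h.indep h.ne_zero h.vec_ne_zero h.eval_fst
    h.eval_snd hp⟩
  · obtain ⟨a, ha⟩ := Projectivization.exists_smul_eq_mk_rep ℂ _
      (combination_ne_zero h.indep h.vec_ne_zero)
    rw [Set.mem_ofPred_eq, VanishesAt, ← ha]
    have h1 : a • ∑ k, ![β, 0, -α] k • w k = (a * β : ℂ) • w 0 + (-(a * α) : ℂ) • w 2 := by
      simp [Fin.sum_univ_three, Units.smul_def, smul_smul]
    rw [h1, h.eval_snd]
    ring
  -- The residual point lies in the span of `w 0` and `w 2`, which does not contain `w 1`.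
  · rw [Ne, Projectivization.mk_eq_mk_iff']
    rintro ⟨a, ha⟩
    have h2 := Fintype.linearIndependent_iff.mp h.indep ![β, -a, -α] (by
      simp only [Fin.sum_univ_three, Matrix.cons_val_zero, Matrix.cons_val_one, Matrix.cons_val,
        neg_smul, zero_smul, add_zero] at ha ⊢
      rw [ha]; abel)
    apply h.vec_ne_zero
    have e0 := h2 0
    have e2 := h2 2
    simp at e0 e2
    simp [e0, e2]

end Linked

/-! ### Forms and their coefficients -/

section Forms

variable {n d : ℕ}

lemma sum_mon (m : Mon n d) : ∑ i, m.1 i = d := (Finset.mem_finsuppAntidiag.mp m.2).1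

lemma degree_mon (m : Mon n d) : m.1.degree = d := by
  rw [Finsupp.degree_eq_sum]
  exact sum_mon m

/-- An exponent of degree `d` as a monomial. -/
def monOf (m : Fin (n + 1) →₀ ℕ) (h : m.degree = d) : Mon n d :=
  ⟨m, Finset.mem_finsuppAntidiag.mpr ⟨by rw [← h, Finsupp.degree_eq_sum], Finset.subset_univ _⟩⟩

lemma isHomogeneous_formOf (c : Mon n d → ℂ) : (formOf c).IsHomogeneous d :=
  IsHomogeneous.sum _ _ _ fun m _ => isHomogeneous_monomial _ (degree_mon m)

lemma coeff_formOf (c : Mon n d → ℂ) (m : Mon n d) : coeff m.1 (formOf c) = c m := by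
  classical
  rw [formOf, coeff_sum, Finset.sum_eq_single m]
  · simp
  · intro m' _ hne
    rw [coeff_monomial, if_neg fun h => hne (Subtype.ext h)]
  · simp

lemma formOf_coeff {H : MvPolynomial (Fin (n + 1)) ℂ} (hH : H.IsHomogeneous d) :
    formOf (fun m : Mon n d => coeff m.1 H) = H := by
  ext m
  by_cases hm : m.degree = d
  · exact coeff_formOf _ (monOf m hm)
  · rw [hH.coeff_eq_zero hm, (isHomogeneous_formOf _).coeff_eq_zero hm]

lemma formOf_smul (a : ℂ) (c : Mon n d → ℂ) : formOf (a • c) = a • formOf c := by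
  simp [formOf, Finset.smul_sum, smul_monomial]

lemma eval_formOf (c : Mon n d → ℂ) (x : Fin (n + 1) → ℂ) :
    eval x (formOf c) = ∑ m : Mon n d, c m * ∏ i, x i ^ m.1 i := by
  simp [formOf, eval_monomial, Finsupp.prod_fintype]

lemma mon_eq_of_add_eq {q r : Fin (n + 1)} (hqr : q ≠ r) (m : Mon n d) (hm : m.1 r + m.1 q = d) :
    m.1 = Finsupp.single r (m.1 r) + Finsupp.single q (m.1 q) := by
  classical
  have h1 := sum_mon m
  rw [← Finset.add_sum_erase _ _ (Finset.mem_univ r), ← Finset.add_sum_erase _ _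
    (Finset.mem_erase.mpr ⟨hqr, Finset.mem_univ q⟩), ← add_assoc, hm] at h1
  have h2 := (Finset.sum_eq_zero_iff.mp (Nat.add_eq_left.mp h1))
  ext i
  by_cases hir : i = r
  · subst hir; simp [hqr]
  by_cases hiq : i = q
  · subst hiq; simp [hqr.symm]
  simp [Ne.symm hir, Ne.symm hiq, h2 i (by simp [hir, hiq])]

lemma eq_single_of_apply_eq {p : Fin (n + 1)} {m : Mon n d} (hm : m.1 p = d) :
    m.1 = Finsupp.single p d := by
  have h1 := sum_mon m
  rw [← Finset.add_sum_erase _ _ (Finset.mem_univ p), hm] at h1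
  have h2 := Finset.sum_eq_zero_iff.mp (Nat.add_eq_left.mp h1)
  ext i
  by_cases hi : i = p
  · subst hi; simp [hm]
  · simp [Ne.symm hi, h2 i (by simp [hi])]

lemma eval_single_formOf (p : Fin (n + 1)) (a : ℂ) (c : Mon n d → ℂ) :
    eval (Pi.single p a) (formOf c) = c (monOf (Finsupp.single p d) (by simp)) * a ^ d := by
  classical
  rw [eval_formOf, Finset.sum_eq_single (monOf (Finsupp.single p d) (by simp))]
  · rw [Finset.prod_eq_single p]
    · simp [monOf]
    · intro i _ hi
      simp [monOf, Ne.symm hi]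
    · simp
  · intro m _ hne
    obtain ⟨i, hi, hi0⟩ : ∃ i, i ≠ p ∧ m.1 i ≠ 0 := by
      by_contra! h0
      have h1 := sum_mon m
      rw [Finset.sum_eq_single p (fun i _ hi => h0 i hi) (by simp)] at h1
      exact hne (Subtype.ext (eq_single_of_apply_eq h1))
    rw [Finset.prod_eq_zero (Finset.mem_univ i), mul_zero]
    simp [hi, hi0]
  · simp

/-- The values of a form on a coordinate line. -/
lemma eval_line_formOf (c : Mon n (n + 1) → ℂ) {q r : Fin (n + 1)} (hqr : q ≠ r)
    (hc : ∀ m : Mon n (n + 1), m.1 r + m.1 q = n + 1 → m.1 r < n → c m = 0) (s t : ℂ) :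
    eval (s • Pi.single q 1 + t • Pi.single r 1) (formOf c) =
      c (monOf (Finsupp.single r n + Finsupp.single q 1) (by simp)) * s * t ^ n +
        c (monOf (Finsupp.single r (n + 1)) (by simp)) * t ^ (n + 1) := by
  classical
  have hval := mon_eq_of_add_eq (d := n + 1) hqr
  have hz (m : Mon n (n + 1)) (hm : m.1 r + m.1 q ≠ n + 1) :
      ∏ i, (s • Pi.single q 1 + t • Pi.single r 1 : Fin (n + 1) → ℂ) i ^ m.1 i = 0 := by
    have h1 := sum_mon m
    obtain ⟨i, hi, hi0⟩ : ∃ i ∈ (Finset.univ.erase r).erase q, m.1 i ≠ 0 := by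
      by_contra! h0
      rw [← Finset.add_sum_erase _ _ (Finset.mem_univ r), ← Finset.add_sum_erase _ _
        (Finset.mem_erase.mpr ⟨hqr, Finset.mem_univ q⟩), Finset.sum_eq_zero h0] at h1
      omega
    simp only [Finset.mem_erase, Finset.mem_univ, and_true] at hi
    refine Finset.prod_eq_zero (Finset.mem_univ i) ?_
    simp [hi.1, hi.2, hi0]
  have hp (m : Mon n (n + 1)) (hm : m.1 r + m.1 q = n + 1) :
      ∏ i, (s • Pi.single q 1 + t • Pi.single r 1 : Fin (n + 1) → ℂ) i ^ m.1 i =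
        s ^ m.1 q * t ^ m.1 r := by
    have hm' := hval m hm
    rw [← Finset.mul_prod_erase _ _ (Finset.mem_univ r), ← Finset.mul_prod_erase _ _
      (Finset.mem_erase.mpr ⟨hqr, Finset.mem_univ q⟩), Finset.prod_eq_one]
    · simp [hqr, hqr.symm, mul_comm]
    · intro i hi
      simp only [Finset.mem_erase, Finset.mem_univ, and_true] at hi
      rw [hm']
      simp [Ne.symm hi.1, Ne.symm hi.2]
  rw [eval_formOf, Finset.sum_eq_add (monOf (Finsupp.single r n + Finsupp.single q 1) (by simp))
    (monOf (Finsupp.single r (n + 1)) (by simp)), hp, hp]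
  · simp [monOf, hqr, hqr.symm, mul_assoc]
  · simp [monOf, hqr.symm]
  · simp [monOf, hqr, hqr.symm]
  · intro h
    have := congrArg (fun m : Mon n (n + 1) => m.1 q) h
    simp [monOf, hqr.symm] at this
  · rintro m - ⟨h1, h2⟩
    by_cases hm : m.1 r + m.1 q = n + 1
    · rw [hc m hm, zero_mul]
      by_contra hlt
      have hm' := hval m hm
      rcases (by omega : m.1 r = n ∧ m.1 q = 1 ∨ m.1 r = n + 1 ∧ m.1 q = 0) with ⟨e1, e2⟩ | ⟨e1, e2⟩
      · exact h1 (Subtype.ext (by rw [hm', e1, e2]; rfl))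
      · exact h2 (Subtype.ext (by rw [hm', e1, e2]; simp [monOf]))
    · rw [hz m hm, mul_zero]
  · simp
  · simp

end Forms

/-! ### A dominant family of forms with a linked coordinate point -/

section Family

variable {n : ℕ} {A : Type} [CommRing A]

/-- First order Taylor expansion. -/
lemma aeval_X_add_eps {σ : Type} (G : MvPolynomial σ ℂ) (δ : σ → MvPolynomial σ ℂ)
    [Fintype σ] :
    aeval (fun i => X i + C DualNumber.eps * map (algebraMap ℂ (DualNumber ℂ)) (δ i)) G =
      map (algebraMap ℂ (DualNumber ℂ)) G +
        C DualNumber.eps * map (algebraMap ℂ (DualNumber ℂ)) (∑ i, δ i * pderiv i G) := by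
  classical
  have hε : (C DualNumber.eps * C DualNumber.eps : MvPolynomial σ (DualNumber ℂ)) = 0 := by
    rw [← C_mul, DualNumber.eps_mul_eps, C_0]
  induction G using MvPolynomial.induction_on with
  | C z => simp [MvPolynomial.algebraMap_apply]
  | add p q hp hq =>
    simp only [map_add, hp, hq, mul_add, Finset.sum_add_distrib]
    ring
  | mul_X p i hp =>
    have h1 : ∑ j, δ j * pderiv j (p * X i) = (∑ j, δ j * pderiv j p) * X i + p * δ i := by
      simp only [Derivation.leibniz, pderiv_X, smul_eq_mul, mul_add, Finset.sum_add_distrib]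
      rw [add_comm]
      congr 1
      · rw [Finset.sum_mul]
        exact Finset.sum_congr rfl fun j _ => by ring
      · simp [Pi.single_apply, mul_comm]
    rw [map_mul, hp, aeval_X, h1]
    simp only [map_mul, map_add, map_X]
    linear_combination (map (algebraMap ℂ (DualNumber ℂ)) (∑ j, δ j * pderiv j p) *
      map (algebraMap ℂ (DualNumber ℂ)) (δ i)) * hε

/-- The coordinates of the family: two vectors and the coefficients of a form. -/
abbrev FamilyVar (n : ℕ) : Type := Fin (n + 1) ⊕ Fin (n + 1) ⊕ Mon n (n + 1)

/-- Exponents which do not occur in forms with the standard contact behaviour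
at the coordinate points. -/
def IsExcluded (q p v : Fin (n + 1)) (m : Mon n (n + 1)) : Prop :=
  m.1 p + m.1 q = n + 1 ∧ m.1 p < n ∨ m.1 v + m.1 q = n + 1 ∧ m.1 v < n ∨ m.1 p = n + 1

/-- The substitution `xᵢ ↦ xᵢ + yᵢ x_q + zᵢ x_v`. -/
def famSubst (q v : Fin (n + 1)) (y z : Fin (n + 1) → A) (i : Fin (n + 1)) :
    MvPolynomial (Fin (n + 1)) A :=
  X i + ((if i = q then 0 else C (y i) * X q) + if i = q ∨ i = v then 0 else C (z i) * X v)

open Classical in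
/-- Keep the coefficients which are not excluded. -/
def famCoeff (q p v : Fin (n + 1)) (w : Mon n (n + 1) → A) (m : Mon n (n + 1)) : A :=
  if IsExcluded q p v m then 0 else w m

/-- The form with coefficients `w` after the substitution with parameters `y` and `z`. -/
def famForm (q p v : Fin (n + 1)) (x : FamilyVar n → A) : MvPolynomial (Fin (n + 1)) A :=
  ∑ m : Mon n (n + 1), C (famCoeff q p v (fun m => x (.inr (.inr m))) m) *
    ∏ i, famSubst q v (fun i => x (.inl i)) (fun i => x (.inr (.inl i))) i ^ m.1 i

/-- Naturality in the coefficient ring lets one formula serve as universal family (polynomial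
coefficients), as its members (over `ℂ`) and as its tangent vectors (over the dual numbers). -/
lemma map_famForm {A B : Type} [CommRing A] [CommRing B] (θ : A →+* B) (q p v : Fin (n + 1))
    (x : FamilyVar n → A) : map θ (famForm q p v x) = famForm q p v (fun i => θ (x i)) := by
  have h1 (y z : Fin (n + 1) → A) (i : Fin (n + 1)) : map θ (famSubst q v y z i) =
      famSubst q v (fun i => θ (y i)) (fun i => θ (z i)) i := by
    simp only [famSubst, map_add, map_X]
    split_ifs <;> simp
  have h2 (w : Mon n (n + 1) → A) (m) :
      θ (famCoeff q p v w m) = famCoeff q p v (fun m => θ (w m)) m := by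
    simp only [famCoeff]
    split_ifs <;> simp
  simp only [famForm, map_sum, map_mul, map_C, map_prod, map_pow, h1, h2]

lemma famForm_eq_aeval (q p v : Fin (n + 1)) (x : FamilyVar n → ℂ) :
    famForm q p v x = aeval (famSubst q v (fun i => x (.inl i)) (fun i => x (.inr (.inl i))))
      (formOf (famCoeff q p v (fun m => x (.inr (.inr m))))) := by
  simp only [famForm, formOf, map_sum, aeval_monomial, algebraMap_eq]
  refine Finset.sum_congr rfl fun m _ => ?_
  rw [Finsupp.prod_fintype _ _ (fun i => pow_zero _)]

lemma isHomogeneous_famSubst (q v : Fin (n + 1)) (y z : Fin (n + 1) → ℂ) (i : Fin (n + 1)) :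
    (famSubst q v y z i).IsHomogeneous 1 := by
  refine (isHomogeneous_X _ i).add (IsHomogeneous.add ?_ ?_)
  · split_ifs
    · exact isHomogeneous_zero _ _ _
    · exact isHomogeneous_C_mul_X _ _
  · split_ifs
    · exact isHomogeneous_zero _ _ _
    · exact isHomogeneous_C_mul_X _ _

lemma isHomogeneous_famForm (q p v : Fin (n + 1)) (x : FamilyVar n → ℂ) :
    (famForm q p v x).IsHomogeneous (n + 1) := by
  rw [famForm_eq_aeval]
  simpa using (isHomogeneous_formOf _).aeval _ (isHomogeneous_famSubst q v _ _)

/-- The exponent `a e_r + b e_q`. -/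
abbrev lineMon (r q : Fin (n + 1)) : Mon n (n + 1) :=
  monOf (Finsupp.single r n + Finsupp.single q 1) (by simp)

variable {q p v : Fin (n + 1)} (hqp : q ≠ p) (hqv : q ≠ v) (hpv : p ≠ v)
include hqp hqv hpv

/-- The member is a standard-contact form composed with a linear map `T` fixing `e_p`. Preimages of
`e_q` and `e_v` under `T` complete the contact frame. -/
lemma isLinked_famForm (x : FamilyVar n → ℂ)
    (h1 : famCoeff q p v (fun m => x (.inr (.inr m))) (lineMon p q) ≠ 0)
    (h2 : famCoeff q p v (fun m => x (.inr (.inr m))) (lineMon v q) ≠ 0) :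
    IsLinked n (famForm q p v x) (Pi.single p 1) := by
  classical
  set c := famCoeff q p v (fun m => x (.inr (.inr m))) with hc
  set y : Fin (n + 1) → ℂ := fun i => x (.inl i)
  set z : Fin (n + 1) → ℂ := fun i => x (.inr (.inl i))
  have hc0 (m) (hm : IsExcluded q p v m) : c m = 0 := by simp [hc, famCoeff, hm]
  let T : (Fin (n + 1) → ℂ) →ₗ[ℂ] (Fin (n + 1) → ℂ) :=
    { toFun := fun a i => a i + ((if i = q then 0 else y i * a q) +
        if i = q ∨ i = v then 0 else z i * a v)
      map_add' := fun a b => by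
        ext i
        simp only [Pi.add_apply]
        split_ifs <;> ring
      map_smul' := fun r a => by
        ext i
        simp only [Pi.smul_apply, smul_eq_mul, RingHom.id_apply]
        split_ifs <;> ring }
  -- Explicit preimages of `e_v` and `e_q`. Subtracting the `y i` from `e_q` off the `v`-th entry
  -- leaves an error `y v • e_v`, removed by means of `v'`.
  let v' : Fin (n + 1) → ℂ := Pi.single v 1 - fun i => if i = q ∨ i = v then 0 else z i
  let q' : Fin (n + 1) → ℂ := Pi.single q 1 - (fun i => if i = q ∨ i = v then 0 else y i) -
    y v • v'
  have hTp : T (Pi.single p 1) = Pi.single p 1 := by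
    ext i
    simp [T, hqp, hpv.symm]
  have hTv : T v' = Pi.single v 1 := by
    ext i
    by_cases hiq : i = q
    · subst hiq; simp [T, v', hqv]
    by_cases hiv : i = v
    · subst hiv; simp [T, v', hqv, hqv.symm]
    · simp [T, v', hqv, hiq, hiv]
  have hTq : T q' = Pi.single q 1 := by
    have hT1 : T (Pi.single q 1 - (fun i => if i = q ∨ i = v then 0 else y i)) =
        Pi.single q 1 + y v • Pi.single v 1 := by
      ext i
      by_cases hiq : i = q
      · subst hiq; simp [T, hqv]
      by_cases hiv : i = v
      · subst hiv; simp [T, hqv.symm]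
      · simp [T, hqv.symm, hiq, hiv]
    rw [show q' = (Pi.single q 1 - (fun i => if i = q ∨ i = v then 0 else y i)) - y v • v' from rfl,
      map_sub, hT1, map_smul, hTv, add_sub_cancel_right]
  have hTw : (fun k => T (![q', Pi.single p 1, v'] k)) =
      ![Pi.single q 1, Pi.single p 1, Pi.single v 1] := by
    ext1 k
    fin_cases k
    · exact hTq
    · exact hTp
    · exact hTv
  have hind : LinearIndependent ℂ
      ![(Pi.single q 1 : Fin (n + 1) → ℂ), Pi.single p 1, Pi.single v 1] := by
    have hinj : Function.Injective ![q, p, v] := by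
      intro i j hij
      fin_cases i <;> fin_cases j <;> simp_all
    have := (Pi.basisFun ℂ (Fin (n + 1))).linearIndependent.comp _ hinj
    convert! this using 1
    ext k i
    fin_cases k <;> simp
  refine IsLinked.of_map (F := formOf c) (w := ![q', Pi.single p 1, v']) T (fun a => ?_)
    (c := c (lineMon p q)) (α := c (lineMon v q))
    (β := c (monOf (Finsupp.single v (n + 1)) (by simp))) ?_
  · rw [famForm_eq_aeval, eval_aeval]
    congr 2
    ext i
    simp only [famSubst, map_add, eval_X, T, LinearMap.coe_mk, AddHom.coe_mk]
    split_ifs <;> simp [y, z]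
  · rw [hTw]
    refine ⟨hind, h1, fun h => ?_, fun s t => ?_, fun s t => ?_⟩
    · have := congrFun h 2
      simp at this
      exact h2 this
    · simp only [Matrix.cons_val_zero, Matrix.cons_val_one]
      rw [eval_line_formOf c hqp (fun m h h' => hc0 m (Or.inl ⟨h, h'⟩)),
        hc0 (monOf (Finsupp.single p (n + 1)) _) (Or.inr (Or.inr (by simp [monOf])))]
      ring
    · simp only [Matrix.cons_val_zero, Matrix.cons_val]
      rw [eval_line_formOf c hqv (fun m h h' => hc0 m (Or.inr (Or.inl ⟨h, h'⟩)))]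
      ring

omit hqp hqv in
-- The whole family vanishes at `e_p`, so dominance can only be asked for the coefficients other
-- than that of the pure power of `x_p`.
lemma coeff_famForm_top (x : FamilyVar n → ℂ) (hqp : q ≠ p) :
    coeff (Finsupp.single p (n + 1)) (famForm q p v x) = 0 := by
  classical
  have h1 := eval_single_formOf p 1 fun m : Mon n (n + 1) => coeff m.1 (famForm q p v x)
  rw [formOf_coeff (isHomogeneous_famForm q p v x), famForm_eq_aeval, eval_aeval] at h1
  have h2 : (fun i => eval (Pi.single p 1) (famSubst q v (fun i => x (.inl i))
      (fun i => x (.inr (.inl i))) i)) = (Pi.single p 1 : Fin (n + 1) → ℂ) := by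
    ext i
    simp only [famSubst, map_add, eval_X]
    split_ifs <;> simp [hqp, hpv.symm]
  have hex : IsExcluded q p v (monOf (Finsupp.single p (n + 1)) (by simp)) :=
    Or.inr (Or.inr (by simp [monOf]))
  rw [h2, eval_single_formOf, famCoeff, if_pos hex, one_pow, mul_one, mul_one] at h1
  rw [famForm_eq_aeval]
  exact h1.symm

end Family

/-! ### The derivative of the family at the identity substitution. -/

section Derivative

variable {n : ℕ}

/-- The vector field `∑ (yᵢ x_q + zᵢ x_v) ∂ᵢ` applied to `G`. -/
def famDeriv (q v : Fin (n + 1)) (y z : Fin (n + 1) → ℂ) (G : MvPolynomial (Fin (n + 1)) ℂ) :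
    MvPolynomial (Fin (n + 1)) ℂ :=
  ∑ i, ((if i = q then 0 else C (y i) * X q) + if i = q ∨ i = v then 0 else C (z i) * X v) *
    pderiv i G

/-- A tangent vector contributes a variation of the allowed coefficients, plus the vector field of
the infinitesimal substitution applied to the base form. -/
lemma famForm_dual (q p v : Fin (n + 1)) (a H : Mon n (n + 1) → ℂ) (y z : Fin (n + 1) → ℂ) :
    famForm q p v (fun i : FamilyVar n =>
        (TrivSqZeroExt.inl ((Sum.elim 0 (Sum.elim 0 a) : FamilyVar n → ℂ) i) +
          TrivSqZeroExt.inr ((Sum.elim y (Sum.elim z H) : FamilyVar n → ℂ) i) : DualNumber ℂ)) =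
      map (algebraMap ℂ (DualNumber ℂ)) (formOf (famCoeff q p v a)) +
        C DualNumber.eps * map (algebraMap ℂ (DualNumber ℂ)) (formOf (famCoeff q p v H) +
          famDeriv q v y z (formOf (famCoeff q p v a))) := by
  classical
  set δ : Fin (n + 1) → MvPolynomial (Fin (n + 1)) ℂ := fun i =>
    (if i = q then 0 else C (y i) * X q) + if i = q ∨ i = v then 0 else C (z i) * X v with hδ
  have hinr (r : ℂ) : (TrivSqZeroExt.inr r : DualNumber ℂ) = DualNumber.eps * algebraMap ℂ _ r := by
    rw [DualNumber.inr_eq_smul_eps, Algebra.smul_def, mul_comm]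
  have hg (i : Fin (n + 1)) : famSubst q v
      (fun i => (TrivSqZeroExt.inl 0 + TrivSqZeroExt.inr (y i) : DualNumber ℂ))
      (fun i => (TrivSqZeroExt.inl 0 + TrivSqZeroExt.inr (z i) : DualNumber ℂ)) i =
      X i + C DualNumber.eps * map (algebraMap ℂ (DualNumber ℂ)) (δ i) := by
    simp only [famSubst, hδ, TrivSqZeroExt.inl_zero, zero_add, hinr]
    congr 1
    split_ifs <;> simp [C_mul] <;> ring
  have hε : (C DualNumber.eps * C DualNumber.eps :
      MvPolynomial (Fin (n + 1)) (DualNumber ℂ)) = 0 := by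
    rw [← C_mul, DualNumber.eps_mul_eps, C_0]
  have hsum (c : Mon n (n + 1) → ℂ) : aeval (fun i => X i + C DualNumber.eps *
      map (algebraMap ℂ (DualNumber ℂ)) (δ i)) (formOf c) =
      ∑ m : Mon n (n + 1), C (algebraMap ℂ (DualNumber ℂ) (c m)) * ∏ i, (X i + C DualNumber.eps *
      map (algebraMap ℂ (DualNumber ℂ)) (δ i)) ^ m.1 i := by
    simp only [formOf, map_sum, aeval_monomial, MvPolynomial.algebraMap_apply]
    refine Finset.sum_congr rfl fun m _ => ?_
    rw [Finsupp.prod_fintype _ _ (fun i => pow_zero _)]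
  have hc (m : Mon n (n + 1)) : famCoeff q p v
      (fun m => (TrivSqZeroExt.inl (a m) + TrivSqZeroExt.inr (H m) : DualNumber ℂ)) m =
      algebraMap ℂ _ (famCoeff q p v a m) +
        DualNumber.eps * algebraMap ℂ _ (famCoeff q p v H m) := by
    simp only [famCoeff]
    split_ifs
    · simp
    · rw [hinr]; rfl
  have key : famForm q p v (fun i : FamilyVar n =>
        (TrivSqZeroExt.inl ((Sum.elim 0 (Sum.elim 0 a) : FamilyVar n → ℂ) i) +
          TrivSqZeroExt.inr ((Sum.elim y (Sum.elim z H) : FamilyVar n → ℂ) i) : DualNumber ℂ)) =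
      aeval (fun i => X i + C DualNumber.eps * map (algebraMap ℂ (DualNumber ℂ)) (δ i))
        (formOf (famCoeff q p v a)) + C DualNumber.eps *
      aeval (fun i => X i + C DualNumber.eps * map (algebraMap ℂ (DualNumber ℂ)) (δ i))
        (formOf (famCoeff q p v H)) := by
    rw [hsum, hsum, Finset.mul_sum, ← Finset.sum_add_distrib, famForm]
    refine Finset.sum_congr rfl fun m _ => ?_
    simp only [Sum.elim_inl, Sum.elim_inr, Pi.zero_apply, hg, hc, C_add, C_mul]
    ring
  rw [key, aeval_X_add_eps, aeval_X_add_eps, famDeriv]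
  simp only [map_add]
  linear_combination (map (algebraMap ℂ (DualNumber ℂ))
    (∑ i, δ i * pderiv i (formOf (famCoeff q p v H)))) * hε

lemma snd_coeff_famForm_dual (q p v : Fin (n + 1)) (a H : Mon n (n + 1) → ℂ)
    (y z : Fin (n + 1) → ℂ) (k : Fin (n + 1) →₀ ℕ) :
    (dualEval (Sum.elim 0 (Sum.elim 0 a)) (Sum.elim y (Sum.elim z H))
      (coeff k (famForm q p v (X : FamilyVar n → MvPolynomial (FamilyVar n) ℂ)))).snd =
      coeff k (formOf (famCoeff q p v H)) +
        coeff k (famDeriv q v y z (formOf (famCoeff q p v a))) := by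
  set x₀ : FamilyVar n → ℂ := Sum.elim 0 (Sum.elim 0 a) with hx₀
  set u : FamilyVar n → ℂ := Sum.elim y (Sum.elim z H) with hu
  have h1 : dualEval x₀ u
      (coeff k (famForm q p v (X : FamilyVar n → MvPolynomial (FamilyVar n) ℂ))) =
      coeff k (famForm q p v fun i : FamilyVar n =>
        (TrivSqZeroExt.inl (x₀ i) + TrivSqZeroExt.inr (u i) : DualNumber ℂ)) := by
    have := map_famForm (dualEval x₀ u : MvPolynomial (FamilyVar n) ℂ →+* DualNumber ℂ) q p v
      (X : FamilyVar n → MvPolynomial (FamilyVar n) ℂ)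
    have h2 : (fun i : FamilyVar n => (dualEval x₀ u : MvPolynomial (FamilyVar n) ℂ →+*
        DualNumber ℂ) (X i)) = fun i => TrivSqZeroExt.inl (x₀ i) + TrivSqZeroExt.inr (u i) := by
      ext1 i
      exact aeval_X _ i
    rw [h2] at this
    rw [← this, coeff_map]
    rfl
  rw [h1, hx₀, hu, famForm_dual, coeff_add, coeff_C_mul, coeff_map, coeff_map, coeff_add]
  simp [TrivSqZeroExt.algebraMap_eq_inl]

/-- The part of `famDeriv` along `x_q`. -/
def famDerivFst (q : Fin (n + 1)) (y : Fin (n + 1) → ℂ) (G : MvPolynomial (Fin (n + 1)) ℂ)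
    (k : Fin (n + 1) →₀ ℕ) : ℂ :=
  ∑ i, if i = q ∨ k q = 0 then 0 else
    y i * (coeff (k - Finsupp.single q 1 + Finsupp.single i 1) G * (k i + 1))

/-- The part of `famDeriv` along `x_v`. -/
def famDerivSnd (q v : Fin (n + 1)) (z : Fin (n + 1) → ℂ) (G : MvPolynomial (Fin (n + 1)) ℂ)
    (k : Fin (n + 1) →₀ ℕ) : ℂ :=
  ∑ i, if i = q ∨ i = v ∨ k v = 0 then 0 else
    z i * (coeff (k - Finsupp.single v 1 + Finsupp.single i 1) G * (k i + 1))

lemma coeff_famDeriv (q v : Fin (n + 1)) (y z : Fin (n + 1) → ℂ)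
    (G : MvPolynomial (Fin (n + 1)) ℂ) (k : Fin (n + 1) →₀ ℕ) :
    coeff k (famDeriv q v y z G) = famDerivFst q y G k + famDerivSnd q v z G k := by
  classical
  have h (c : ℂ) (r i : Fin (n + 1)) (hir : i ≠ r) : coeff k (C c * X r * pderiv i G) =
      if k r = 0 then 0 else
        c * (coeff (k - Finsupp.single r 1 + Finsupp.single i 1) G * (k i + 1)) := by
    rw [mul_assoc, coeff_C_mul, coeff_X_mul', coeff_pderiv]
    by_cases hk : k r = 0
    · simp [hk]
    · simp [hk, hir.symm]
  rw [famDeriv, coeff_sum, famDerivFst, famDerivSnd, ← Finset.sum_add_distrib]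
  refine Finset.sum_congr rfl fun i _ => ?_
  by_cases hq : i = q
  · simp [hq]
  by_cases hv : i = v
  · by_cases hk : k q = 0 <;> simp [hv, hv ▸ hq, h _ _ _ (hv ▸ hq), hk]
  · by_cases hk : k q = 0 <;> by_cases hk' : k v = 0 <;>
      simp [hq, hv, add_mul, h _ _ _ hq, h _ _ _ hv, hk, hk']

end Derivative

/-! ### An explicit form for the submersion argument. -/

section BasePoint

variable {n : ℕ}

open Classical in
/-- The coefficients of a form at which the family is submersive. -/
def baseCoeff (q p v : Fin (n + 1)) (m : Mon n (n + 1)) : ℂ :=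
  -- The monomials are `x_q^(n-j) x_p^j x_j`, `x_q^(n-j) x_v^j x_j` and `x_q x_v^n`. Applying `x_q
  -- ∂_j` to the first kind, or `x_v ∂_j` to the second, produces one excluded monomial per
  -- parameter. With `q = n`, `p = n - 1`, `v = 1`, the case `j = v` missing from the second kind is
  -- replaced by `x_q^(n-1) x_v x_p`, which the first kind already contains.
  if (∃ j : Fin (n + 1), j ≠ q ∧
        m.1 = Finsupp.single q (n - j) + Finsupp.single p (j : ℕ) + Finsupp.single j 1) ∨
      (∃ j : Fin (n + 1), j ≠ q ∧ j ≠ p ∧ j ≠ v ∧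
        m.1 = Finsupp.single q (n - j) + Finsupp.single v (j : ℕ) + Finsupp.single j 1) ∨
      m = lineMon v q then 1 else 0

variable {q p v : Fin (n + 1)} (hn : 3 ≤ n) (hq : (q : ℕ) = n) (hp : (p : ℕ) = n - 1)
  (hv : (v : ℕ) = 1)
include hn hq hp hv

lemma not_isExcluded_lineMon : ¬ IsExcluded q p v (lineMon v q) := by
  simp only [IsExcluded, lineMon, monOf, Finsupp.add_apply, Finsupp.single_apply, Fin.ext_iff, hq,
    hp, hv]
  grind

/-- The matrix of the `y`-parameters against the excluded monomials on the line `e_q e_p` is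
diagonal, up to the multiplicities brought in by differentiation. -/
lemma baseCoeff_fst (j i : Fin (n + 1)) (hj : j ≠ q) (hi : i ≠ q)
    (hd : (Finsupp.single q (n - j) + Finsupp.single p (j : ℕ) + Finsupp.single i 1).degree =
      n + 1) :
    famCoeff q p v (baseCoeff q p v) (monOf _ hd) = if i = j then 1 else 0 := by
  have hj' : (j : ℕ) ≠ n := fun h => hj (Fin.ext (by omega))
  have hi' : (i : ℕ) ≠ n := fun h => hi (Fin.ext (by omega))
  have hjn := j.2
  split_ifs with h
  · subst h
    have hex : ¬ IsExcluded q p v (monOf _ hd) := by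
      simp only [IsExcluded, monOf, Finsupp.add_apply, Finsupp.single_apply, Fin.ext_iff, hq,
        hp, hv]
      grind
    rw [famCoeff, if_neg hex, baseCoeff, if_pos (Or.inl ⟨i, hi, rfl⟩)]
  · rw [famCoeff]
    split_ifs
    · rfl
    rw [baseCoeff, if_neg]
    rintro (⟨k, hk, e⟩ | ⟨k, hk, hkp, hkv, e⟩ | e)
    · have e1 := DFunLike.congr_fun e q
      have hk' : (k : ℕ) ≠ n := fun h => hk (Fin.ext (by omega))
      simp only [monOf, Finsupp.add_apply, Finsupp.single_apply, Fin.ext_iff, hq, hp] at e1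
      have hkj : k = j := Fin.ext (by clear e; grind)
      subst hkj
      have e2 := (Finsupp.single_left_inj one_ne_zero).mp (add_left_cancel e)
      exact h e2
    · have e1 := DFunLike.congr_fun e q
      have hk' : (k : ℕ) ≠ n := fun h => hk (Fin.ext (by omega))
      simp only [monOf, Finsupp.add_apply, Finsupp.single_apply, Fin.ext_iff, hq, hp, hv] at e1
      have hkj : k = j := Fin.ext (by clear e; grind)
      subst hkj
      have e2 := DFunLike.congr_fun e v
      have e3 := DFunLike.congr_fun e k
      simp only [monOf, Finsupp.add_apply, Finsupp.single_apply, Fin.ext_iff, hq, hp, hv] at e2 e3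
      have h' : (i : ℕ) ≠ k := fun h' => h (Fin.ext h')
      have hkp' : (k : ℕ) ≠ n - 1 := fun h' => hkp (Fin.ext (h'.trans hp.symm))
      have hkv' : (k : ℕ) ≠ 1 := fun h' => hkv (Fin.ext (h'.trans hv.symm))
      clear e1 e
      grind
    · have e1 := DFunLike.congr_fun (congrArg Subtype.val e) q
      have e2 := DFunLike.congr_fun (congrArg Subtype.val e) v
      simp only [lineMon, monOf, Finsupp.add_apply, Finsupp.single_apply, Fin.ext_iff, hq, hp,
        hv] at e1 e2
      grind

/-- The matrix of the `z`-parameters on the line `e_q e_v` is a permutation matrix. There is no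
parameter `z_v`, so `l = 1` is served by `i = p`, an index that no other `l ≤ n - 2` uses. -/
lemma baseCoeff_snd (l : ℕ) (hl : l + 1 < n) (i : Fin (n + 1)) (hi : i ≠ q) (hiv : i ≠ v)
    (hd : (Finsupp.single q (n - l) + Finsupp.single v l + Finsupp.single i 1).degree =
      n + 1) :
    famCoeff q p v (baseCoeff q p v) (monOf _ hd) =
      if (i : ℕ) = (if l = 1 then n - 1 else l) then 1 else 0 := by
  have hi' : (i : ℕ) ≠ n := fun h => hi (Fin.ext (by omega))
  have hiv' : (i : ℕ) ≠ 1 := fun h => hiv (Fin.ext (by omega))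
  have hin := i.2
  by_cases h : (i : ℕ) = (if l = 1 then n - 1 else l)
  · rw [if_pos h]
    have hex : ¬ IsExcluded q p v (monOf _ hd) := by
      simp only [IsExcluded, monOf, Finsupp.add_apply, Finsupp.single_apply, Fin.ext_iff, hq,
        hp, hv]
      grind
    rw [famCoeff, if_neg hex, baseCoeff, if_pos]
    split_ifs at h with hl1
    · refine Or.inl ⟨v, fun h => by rw [Fin.ext_iff] at h; omega, ?_⟩
      have : i = p := Fin.ext (by omega)
      subst this hl1
      rw [hv, monOf]
      exact add_right_comm _ _ _ |>.trans (by abel)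
    · refine Or.inr (Or.inl ⟨i, hi, fun h => by rw [Fin.ext_iff] at h; omega, hiv, ?_⟩)
      rw [h]
      rfl
  · rw [if_neg h, famCoeff]
    split_ifs
    · rfl
    rw [baseCoeff, if_neg]
    rintro (⟨k, hk, e⟩ | ⟨k, hk, hkp, hkv, e⟩ | e)
    · have hk' : (k : ℕ) ≠ n := fun h => hk (Fin.ext (by omega))
      have e1 := DFunLike.congr_fun e q
      have e2 := DFunLike.congr_fun e v
      have e3 := DFunLike.congr_fun e p
      have e4 := DFunLike.congr_fun e i
      simp only [monOf, Finsupp.add_apply, Finsupp.single_apply, Fin.ext_iff, hq, hp, hv] at e1 e2 e3 e4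
      have hkl : (k : ℕ) = l := by clear e; grind
      rw [hkl] at e2 e3 e4
      clear e1 e
      grind
    · have hk' : (k : ℕ) ≠ n := fun h => hk (Fin.ext (by omega))
      have e1 := DFunLike.congr_fun e q
      have e4 := DFunLike.congr_fun e i
      simp only [monOf, Finsupp.add_apply, Finsupp.single_apply, Fin.ext_iff, hq, hv] at e1 e4
      have hkl : (k : ℕ) = l := by clear e; grind
      have hkp' : (k : ℕ) ≠ n - 1 := fun h' => hkp (Fin.ext (h'.trans hp.symm))
      have hkv' : (k : ℕ) ≠ 1 := fun h' => hkv (Fin.ext (h'.trans hv.symm))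
      rw [hkl] at e4 hkp' hkv'
      clear e1 e
      grind
    · have e1 := DFunLike.congr_fun (congrArg Subtype.val e) q
      have e2 := DFunLike.congr_fun (congrArg Subtype.val e) v
      simp only [lineMon, monOf, Finsupp.add_apply, Finsupp.single_apply, Fin.ext_iff, hq,
        hv] at e1 e2
      grind

end BasePoint

/-! ### Surjectivity of the derivative and dominance. -/

section Submersion

variable {n : ℕ} {q p v : Fin (n + 1)}

/-- The form with coefficients `baseCoeff`. -/
def baseForm (q p v : Fin (n + 1)) : MvPolynomial (Fin (n + 1)) ℂ :=
  formOf (famCoeff q p v (baseCoeff q p v))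

/-- The exponent `(n + 1 - i) e_q + i e_p`. -/
def fstMon (q p : Fin (n + 1)) (j : Fin (n + 1)) : Mon n (n + 1) :=
  monOf (Finsupp.single q (n + 1 - j) + Finsupp.single p (j : ℕ)) (by
    have := j.2
    simp only [map_add, Finsupp.degree_single]
    omega)

/-- The exponent `(n - l) e_q + (l + 1) e_v`. -/
def sndMon (q v : Fin (n + 1)) (l : ℕ) (hl : l < n) : Mon n (n + 1) :=
  monOf (Finsupp.single q (n - l) + Finsupp.single v (l + 1)) (by
    simp only [map_add, Finsupp.degree_single]
    omega)

lemma eq_fstMon {m : Mon n (n + 1)} (hqp : q ≠ p) (h1 : m.1 p + m.1 q = n + 1) (h2 : m.1 p < n) :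
    ∃ j : Fin (n + 1), (j : ℕ) < n ∧ m = fstMon q p j := by
  refine ⟨⟨m.1 p, by omega⟩, h2, Subtype.ext ?_⟩
  refine (mon_eq_of_add_eq hqp m h1).trans ?_
  simp only [fstMon, monOf]
  rw [add_comm (Finsupp.single p _)]
  congr 2
  omega

lemma eq_sndMon {m : Mon n (n + 1)} (hqv : q ≠ v) (h1 : m.1 v + m.1 q = n + 1) (h2 : m.1 v < n)
    (h3 : m.1 v ≠ 0) : ∃ (l : ℕ) (hl : l + 1 < n), m = sndMon q v l (Nat.lt_of_succ_lt hl) := by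
  refine ⟨m.1 v - 1, by omega, Subtype.ext ?_⟩
  refine (mon_eq_of_add_eq hqv m h1).trans ?_
  simp only [sndMon, monOf]
  rw [add_comm (Finsupp.single v _)]
  congr 2 <;> omega

lemma eq_fstMon_zero {m : Mon n (n + 1)} (hqv : q ≠ v) (h1 : m.1 v + m.1 q = n + 1)
    (h3 : m.1 v = 0) : m = fstMon q p 0 := by
  refine Subtype.ext ?_
  rw [mon_eq_of_add_eq hqv m h1]
  simp only [fstMon, monOf, h3]
  have : m.1 q = n + 1 := by omega
  simp [this]

variable (hn : 3 ≤ n) (hq : (q : ℕ) = n) (hp : (p : ℕ) = n - 1) (hv : (v : ℕ) = 1)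
include hn hq hp hv

lemma famDerivFst_fstMon (y : Fin (n + 1) → ℂ) (j : Fin (n + 1)) (hj : (j : ℕ) < n) :
    famDerivFst q y (baseForm q p v) (fstMon q p j).1 = y j * (if j = p then (n : ℂ) else 1) := by
  classical
  have hjq : j ≠ q := fun h => by rw [h, hq] at hj; omega
  have hqp : q ≠ p := fun h => by rw [h] at hq; omega
  have hkq : (fstMon q p j).1 q ≠ 0 := by
    simp [fstMon, monOf, hqp.symm]
    omega
  have hterm (i : Fin (n + 1)) (hi : i ≠ q) :
      coeff ((fstMon q p j).1 - Finsupp.single q 1 + Finsupp.single i 1) (baseForm q p v) =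
        if i = j then 1 else 0 := by
    have e : (fstMon q p j).1 - Finsupp.single q 1 + Finsupp.single i 1 =
        Finsupp.single q (n - j) + Finsupp.single p (j : ℕ) + Finsupp.single i 1 := by
      congr 1
      ext r
      simp only [fstMon, monOf, Finsupp.tsub_apply, Finsupp.add_apply, Finsupp.single_apply]
      by_cases hr : q = r
      · subst hr; simp [hqp.symm]; omega
      · simp [hr]
    have hd : (Finsupp.single q (n - j) + Finsupp.single p (j : ℕ) + Finsupp.single i 1).degree =
      n + 1 := by
      simp only [map_add, Finsupp.degree_single]
      omega
    rw [e, ← baseCoeff_fst hn hq hp hv j i hjq hi hd]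
    exact coeff_formOf _ (monOf _ hd)
  rw [famDerivFst, Finset.sum_eq_single j]
  · rw [if_neg (by tauto), hterm j hjq, if_pos rfl, one_mul]
    congr 1
    -- For `j = p` the relevant monomial is `x_q x_p^n`, whose derivative brings down the factor
    -- `n`.
    split_ifs with h
    · subst h
      have : ((n : ℕ) : ℂ) = ((n - 1 : ℕ) : ℂ) + 1 := by
        rw [← Nat.cast_succ]
        congr 1
        omega
      simp [fstMon, monOf, hqp, hp, this]
    · simp [fstMon, monOf, hjq.symm, Ne.symm h]
  · intro i _ hij
    by_cases hi : i = q
    · rw [if_pos (Or.inl hi)]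
    · rw [if_neg (by tauto), hterm i hi, if_neg hij]
      ring
  · simp

/-- Monomials on the line `e_q e_p` do not involve `x_v`. This makes the linear system block
triangular: `y` is found first, then `z`. -/
lemma famDerivSnd_fstMon (z : Fin (n + 1) → ℂ) (G : MvPolynomial (Fin (n + 1)) ℂ)
    (j : Fin (n + 1)) : famDerivSnd q v z G (fstMon q p j).1 = 0 := by
  refine Finset.sum_eq_zero fun i _ => if_pos (Or.inr (Or.inr ?_))
  have h1 : q ≠ v := fun h => by rw [h] at hq; omega
  have h2 : p ≠ v := fun h => by rw [h] at hp; omega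
  simp [fstMon, monOf, h1, h2]

lemma famDerivSnd_sndMon (z : Fin (n + 1) → ℂ) (l : ℕ) (hl : l + 1 < n) (i₀ : Fin (n + 1))
    (hi₀ : (i₀ : ℕ) = if l = 1 then n - 1 else l) :
    famDerivSnd q v z (baseForm q p v) (sndMon q v l (by omega)).1 = z i₀ := by
  classical
  have hqv : q ≠ v := fun h => by rw [h] at hq; omega
  have hi₀q : i₀ ≠ q := fun h => by rw [h, hq] at hi₀; grind
  have hi₀v : i₀ ≠ v := fun h => by rw [h, hv] at hi₀; grind
  have hkv : (sndMon q v l (by omega)).1 v ≠ 0 := by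
    simp [sndMon, monOf]
  have hki (i : Fin (n + 1)) (hi : i ≠ q) (hiv : i ≠ v) : (sndMon q v l (by omega)).1 i = 0 := by
    simp [sndMon, monOf, hi.symm, hiv.symm]
  have hterm (i : Fin (n + 1)) (hi : i ≠ q) (hiv : i ≠ v) :
      coeff ((sndMon q v l (by omega)).1 - Finsupp.single v 1 + Finsupp.single i 1)
        (baseForm q p v) = if i = i₀ then 1 else 0 := by
    have e : (sndMon q v l (by omega)).1 - Finsupp.single v 1 + Finsupp.single i 1 =
        Finsupp.single q (n - l) + Finsupp.single v l + Finsupp.single i 1 := by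
      congr 1
      ext r
      simp only [sndMon, monOf, Finsupp.tsub_apply, Finsupp.add_apply, Finsupp.single_apply]
      by_cases hr : v = r
      · subst hr; simp [hqv]
      · simp [hr]
    have hd : (Finsupp.single q (n - l) + Finsupp.single v l + Finsupp.single i 1).degree =
      n + 1 := by
      simp only [map_add, Finsupp.degree_single]
      omega
    have h1 := baseCoeff_snd hn hq hp hv l hl i hi hiv hd
    rw [← hi₀] at h1
    simp only [← Fin.ext_iff] at h1
    rw [e, ← h1]
    exact coeff_formOf _ (monOf _ hd)
  rw [famDerivSnd, Finset.sum_eq_single i₀]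
  · rw [if_neg (by tauto), hterm i₀ hi₀q hi₀v, if_pos rfl, hki i₀ hi₀q hi₀v]
    simp
  · intro i _ hij
    split_ifs with h
    · rfl
    · rw [hterm i (by tauto) (by tauto), if_neg hij]
      ring
  · simp

/-- The derivative of the family at the base point is surjective. -/
lemma exists_famDeriv_eq (t : Mon n (n + 1) → ℂ) :
    ∃ (y z : Fin (n + 1) → ℂ) (H : Mon n (n + 1) → ℂ),
      ∀ k : Mon n (n + 1), k.1 p ≠ n + 1 →
        coeff k.1 (formOf (famCoeff q p v H)) +
          coeff k.1 (famDeriv q v y z (baseForm q p v)) = t k := by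
  classical
  have hqv : q ≠ v := fun h => by rw [h] at hq; omega
  have hqp : q ≠ p := fun h => by rw [h] at hq; omega
  have hn0 : (n : ℂ) ≠ 0 := by
    rw [Nat.cast_ne_zero]
    omega
  let y : Fin (n + 1) → ℂ := fun j => t (fstMon q p j) / (if j = p then (n : ℂ) else 1)
  -- The index condition inverts the matching `l ↦ i₀`, with `p` serving `l = 1`; the contribution
  -- of the already chosen `y` is subtracted.
  let z : Fin (n + 1) → ℂ := fun i =>
    if hl : (if i = p then 1 else (i : ℕ)) < n then
      t (sndMon q v _ hl) - famDerivFst q y (baseForm q p v) (sndMon q v _ hl).1 else 0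
  have hfst (j : Fin (n + 1)) (hj : (j : ℕ) < n) :
      coeff (fstMon q p j).1 (famDeriv q v y z (baseForm q p v)) = t (fstMon q p j) := by
    rw [coeff_famDeriv, famDerivFst_fstMon hn hq hp hv y j hj,
      famDerivSnd_fstMon hn hq hp hv, add_zero, div_mul_cancel₀]
    split_ifs
    · exact hn0
    · exact one_ne_zero
  have hsnd (l : ℕ) (hl : l + 1 < n) :
      coeff (sndMon q v l (by omega)).1 (famDeriv q v y z (baseForm q p v)) =
        t (sndMon q v l (by omega)) := by
    obtain ⟨i₀, hi₀⟩ : ∃ i₀ : Fin (n + 1), (i₀ : ℕ) = if l = 1 then n - 1 else l :=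
      ⟨⟨if l = 1 then n - 1 else l, by split_ifs <;> omega⟩, rfl⟩
    have hz : (if i₀ = p then 1 else (i₀ : ℕ)) = l := by
      simp only [Fin.ext_iff, hp, hi₀]
      grind
    rw [coeff_famDeriv, famDerivSnd_sndMon hn hq hp hv z l hl i₀ hi₀]
    simp only [z, hz]
    rw [dif_pos (by omega)]
    ring
  -- Allowed coefficients are corrected freely by `H`; only the excluded ones constrain `y` and `z`.
  refine ⟨y, z, fun k => t k - coeff k.1 (famDeriv q v y z (baseForm q p v)), fun k hk => ?_⟩
  rw [coeff_formOf, famCoeff]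
  split_ifs with hex
  · rw [zero_add]
    rcases hex with ⟨h1, h2⟩ | ⟨h1, h2⟩ | h
    · obtain ⟨j, hj, rfl⟩ := eq_fstMon hqp h1 h2
      exact hfst j hj
    -- The monomial `x_q^(n+1)` is excluded on both lines and has already been handled by `y_0`.
    · by_cases h3 : k.1 v = 0
      · rw [eq_fstMon_zero (p := p) hqv h1 h3]
        exact hfst 0 (by simp; omega)
      · obtain ⟨l, hl, rfl⟩ := eq_sndMon hqv h1 h2 h3
        exact hsnd l hl
    · exact absurd h hk
  · ring

/-- A general form vanishing at the coordinate point `p` is linked at `p`. -/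
theorem exists_generic_linked :
    ∃ φ : MvPolynomial {m : Mon n (n + 1) // m.1 p ≠ n + 1} ℂ, φ ≠ 0 ∧
      ∀ c : Mon n (n + 1) → ℂ, (∀ m, m.1 p = n + 1 → c m = 0) →
        eval (fun m => c m.1) φ ≠ 0 → IsLinked n (formOf c) (Pi.single p 1) := by
  classical
  have hqv : q ≠ v := fun h => by rw [h] at hq; omega
  have hqp : q ≠ p := fun h => by rw [h] at hq; omega
  have hpv : p ≠ v := fun h => by rw [h] at hp; omega
  let X' : FamilyVar n → MvPolynomial (FamilyVar n) ℂ := X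
  -- Nonvanishing of `h` keeps `c` and `α` nonzero in the contact frame.
  let h : MvPolynomial (FamilyVar n) ℂ :=
    famCoeff q p v (fun m => X' (.inr (.inr m))) (lineMon p q) *
      famCoeff q p v (fun m => X' (.inr (.inr m))) (lineMon v q)
  have hx1 : ¬ IsExcluded q p v (lineMon v q) := not_isExcluded_lineMon hn hq hp hv
  have hx2 : ¬ IsExcluded q p v (lineMon p q) := by
    simp only [IsExcluded, lineMon, monOf, Finsupp.add_apply, Finsupp.single_apply, Fin.ext_iff,
      hq, hp, hv]
    grind
  have hh : h ≠ 0 := by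
    simp only [h, famCoeff, if_neg hx1, if_neg hx2]
    exact mul_ne_zero (X_ne_zero _) (X_ne_zero _)
  obtain ⟨φ, hφ, H⟩ := exists_ne_zero_forall_mem_range
    (fun k : {m : Mon n (n + 1) // m.1 p ≠ n + 1} => coeff k.1.1 (famForm q p v X'))
    (Sum.elim 0 (Sum.elim 0 (baseCoeff q p v))) (fun t => by
      obtain ⟨y, z, H, hH⟩ := exists_famDeriv_eq hn hq hp hv
        (fun k => if hk : k.1 p ≠ n + 1 then t ⟨k, hk⟩ else 0)
      refine ⟨Sum.elim y (Sum.elim z H), fun k => ?_⟩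
      rw [snd_coeff_famForm_dual]
      refine (hH k.1 k.2).trans ?_
      rw [dif_pos k.2]) hh
  refine ⟨φ, hφ, fun c hc0 hc => ?_⟩
  obtain ⟨x, hx, hxc⟩ := H _ hc
  have hev : map (eval x) (famForm q p v X') = famForm q p v x := by
    rw [map_famForm]
    simp [X']
  have hform : formOf c = famForm q p v x := by
    rw [← formOf_coeff (isHomogeneous_famForm q p v x)]
    congr 1
    ext m
    by_cases hm : m.1 p = n + 1
    · rw [hc0 m hm]
      rw [eq_single_of_apply_eq hm]
      exact (coeff_famForm_top hpv x hqp).symm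
    · rw [← hxc ⟨m, hm⟩, ← hev, coeff_map]
  rw [hform]
  simp only [h, map_mul, famCoeff, if_neg hx1, if_neg hx2, X', eval_X] at hx
  refine isLinked_famForm hqp hqv hpv x ?_ ?_
  · rw [famCoeff, if_neg hx2]
    exact left_ne_zero_of_mul hx
  · rw [famCoeff, if_neg hx1]
    exact right_ne_zero_of_mul hx

end Submersion

/-! ### Homogeneity and representatives -/

section Scaling

lemma eval_pow_mul_of_isWeightedHomogeneous {σ : Type*} {w : σ → ℕ} {F : MvPolynomial σ ℂ} {k : ℕ}
    (h : IsWeightedHomogeneous w F k) (s : ℂ) (x : σ → ℂ) :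
    eval (fun i => s ^ w i * x i) F = s ^ k * eval x F := by
  rw [eval_eq, eval_eq, Finset.mul_sum]
  refine Finset.sum_congr rfl fun d hd => ?_
  have h1 : ∑ i ∈ d.support, w i * d i = k := by
    rw [← h (mem_support_iff.mp hd), Finsupp.weight_apply, Finsupp.sum]
    simp [mul_comm]
  rw [← h1, ← Finset.prod_pow_eq_pow_sum, mul_left_comm, ← Finset.prod_mul_distrib]
  simp only [mul_pow, pow_mul]

lemma eval_smul_of_isHomogeneous {σ : Type*} {F : MvPolynomial σ ℂ} {k : ℕ}
    (h : F.IsHomogeneous k) (s : ℂ) (x : σ → ℂ) : eval (s • x) F = s ^ k * eval x F := by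
  rw [← eval_pow_mul_of_isWeightedHomogeneous h]
  congr 2
  ext i
  simp

lemma IsBihomogeneous.eval_smul_eq_zero_iff {σ τ : Type} {F : MvPolynomial (σ ⊕ τ) ℂ}
    (h : IsBihomogeneous F) {s t : ℂ} (hs : s ≠ 0) (ht : t ≠ 0) (x : σ → ℂ) (c : τ → ℂ) :
    eval (Sum.elim (s • x) (t • c)) F = 0 ↔ eval (Sum.elim x c) F = 0 := by
  obtain ⟨k, l, hk, hl⟩ := h
  have h1 := eval_pow_mul_of_isWeightedHomogeneous hk s (Sum.elim x (t • c))
  have h2 := eval_pow_mul_of_isWeightedHomogeneous hl t (Sum.elim x c)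
  rw [show (fun i => s ^ (Sum.elim (fun _ => 1) (fun _ => 0) : σ ⊕ τ → ℕ) i *
    (Sum.elim x (t • c) : σ ⊕ τ → ℂ) i) = Sum.elim (s • x) (t • c) by
      ext (i | i) <;> simp] at h1
  rw [show (fun i => t ^ (Sum.elim (fun _ => 0) (fun _ => 1) : σ ⊕ τ → ℕ) i *
    (Sum.elim x c : σ ⊕ τ → ℂ) i) = Sum.elim x (t • c) by
      ext (i | i) <;> simp] at h2
  rw [h1, h2]
  simp [hs, ht]

lemma vanishesAt_mk_iff {σ : Type} {F : MvPolynomial σ ℂ} {k : ℕ} (hF : F.IsHomogeneous k)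
    {x : σ → ℂ} (hx : x ≠ 0) : VanishesAt F (Projectivization.mk ℂ x hx) ↔ eval x F = 0 := by
  obtain ⟨a, ha⟩ := Projectivization.exists_smul_eq_mk_rep ℂ x hx
  rw [VanishesAt, ← ha, Units.smul_def, eval_smul_of_isHomogeneous hF]
  simp

lemma hypersurface_mk {n d : ℕ} {c : Mon n d → ℂ} (hc : c ≠ 0) :
    hypersurface (Projectivization.mk ℂ c hc) = {P | VanishesAt (formOf c) P} := by
  obtain ⟨a, ha⟩ := Projectivization.exists_smul_eq_mk_rep ℂ c hc
  ext P
  simp [hypersurface, VanishesAt, ← ha, Units.smul_def, formOf_smul, smul_eval]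

end Scaling

/-! ### Moving a point to a coordinate vertex -/

section Move

variable {n d : ℕ}

/-- The form with coefficients `c` after the coordinate change that sends the `p`-th coordinate
vector to `x` and fixes the others. -/
def moveForm {A : Type*} [CommRing A] (p : Fin (n + 1)) (x : Fin (n + 1) → A) (c : Mon n d → A) :
    MvPolynomial (Fin (n + 1)) A :=
  ∑ m, C (c m) * ∏ i, ((if i = p then 0 else X i) + C (x i) * X p) ^ m.1 i

/-- The coordinate change that sends the `p`-th coordinate vector to `x` and fixes the others. -/
def moveMap (p : Fin (n + 1)) (x : Fin (n + 1) → ℂ) :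
    (Fin (n + 1) → ℂ) →ₗ[ℂ] (Fin (n + 1) → ℂ) :=
  LinearMap.pi fun i => (if i = p then 0 else LinearMap.proj i) + x i • LinearMap.proj p

lemma moveMap_apply (p : Fin (n + 1)) (x y : Fin (n + 1) → ℂ) (i : Fin (n + 1)) :
    moveMap p x y i = (if i = p then 0 else y i) + x i * y p := by
  rw [moveMap, LinearMap.pi_apply]
  split_ifs <;> simp

lemma moveMap_single (p : Fin (n + 1)) (x : Fin (n + 1) → ℂ) : moveMap p x (Pi.single p 1) = x := by
  ext i
  rw [moveMap_apply]
  by_cases hi : i = p <;> simp [hi]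

lemma moveMap_single_self (p : Fin (n + 1)) : moveMap p (Pi.single p 1) = LinearMap.id := by
  refine LinearMap.ext fun y => ?_
  ext i
  rw [moveMap_apply]
  by_cases hi : i = p <;> simp [hi]

lemma ker_moveMap {p : Fin (n + 1)} {x : Fin (n + 1) → ℂ} (hx : x p ≠ 0) :
    LinearMap.ker (moveMap p x) = ⊥ := by
  refine (LinearMap.ker_eq_bot').mpr fun y hy => ?_
  have h (i) := congrFun hy i
  simp only [moveMap_apply, Pi.zero_apply] at h
  have hp : y p = 0 := by simpa [hx] using h p
  ext i
  by_cases hi : i = p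
  · rw [hi, hp]; rfl
  · simpa [hi, hp] using h i

lemma map_moveForm {A B : Type*} [CommRing A] [CommRing B] (θ : A →+* B) (p : Fin (n + 1))
    (x : Fin (n + 1) → A) (c : Mon n d → A) :
    map θ (moveForm p x c) = moveForm p (fun i => θ (x i)) (fun m => θ (c m)) := by
  simp only [moveForm, map_sum, map_mul, map_C, map_prod, map_pow, map_add, map_X]
  congr! 6
  split_ifs <;> simp

lemma eval_moveForm (p : Fin (n + 1)) (x y : Fin (n + 1) → ℂ) (c : Mon n d → ℂ) :
    eval y (moveForm p x c) = eval (moveMap p x y) (formOf c) := by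
  rw [eval_formOf]
  simp only [moveForm, map_sum, map_mul, eval_C, map_prod, map_pow, map_add, eval_X, moveMap_apply]
  congr! 5
  split_ifs <;> simp

lemma isHomogeneous_moveForm (p : Fin (n + 1)) (x : Fin (n + 1) → ℂ) (c : Mon n d → ℂ) :
    (moveForm p x c).IsHomogeneous d := by
  refine IsHomogeneous.sum _ _ _ fun m _ => ?_
  have hprod : (∏ i, ((if i = p then 0 else X i) + C (x i) * X p) ^ m.1 i :
      MvPolynomial (Fin (n + 1)) ℂ).IsHomogeneous (∑ i, 1 * m.1 i) := by
    refine IsHomogeneous.prod _ _ _ fun i _ => IsHomogeneous.pow ?_ _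
    refine IsHomogeneous.add ?_ (isHomogeneous_C_mul_X _ _)
    split_ifs
    · exact isHomogeneous_zero _ _ _
    · exact isHomogeneous_X _ _
  simpa [sum_mon] using (isHomogeneous_C _ (c m)).mul hprod

lemma IsLinked.map {σ : Type} [Fintype σ] {m : ℕ} {F F' : MvPolynomial σ ℂ} {p : σ → ℂ}
    (T : (σ → ℂ) →ₗ[ℂ] (σ → ℂ)) (hT : ∀ x, eval x F' = eval (T x) F)
    (hker : LinearMap.ker T = ⊥) (h : IsLinked m F' p) : IsLinked m F (T p) := by
  obtain ⟨w, c, α, β, rfl, h⟩ := h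
  refine ⟨fun k => T (w k), c, α, β, rfl, h.indep.map' T hker, h.ne_zero, h.vec_ne_zero,
    fun s t => ?_, fun s t => ?_⟩
  · rw [← map_smul, ← map_smul, ← map_add, ← hT]
    exact h.eval_fst s t
  · rw [← map_smul, ← map_smul, ← map_add, ← hT]
    exact h.eval_snd s t

/-- A general point of a general hypersurface of degree `n + 1` is linked. -/
theorem exists_generic_pair (hn : 3 ≤ n) :
    ∃ Φ : MvPolynomial (Fin (n + 1) ⊕ Mon n (n + 1)) ℂ,
      (∀ x c, eval x (formOf c) = 0 → eval (Sum.elim x c) Φ ≠ 0 → IsLinked n (formOf c) x) ∧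
      ∃ x c, x ≠ 0 ∧ eval x (formOf c) = 0 ∧ eval (Sum.elim x c) Φ ≠ 0 := by
  obtain ⟨p, hp⟩ : ∃ p : Fin (n + 1), (p : ℕ) = n - 1 := ⟨⟨n - 1, by omega⟩, rfl⟩
  obtain ⟨φ, hφ, H⟩ := exists_generic_linked hn (q := Fin.last n) (p := p)
    (v := ⟨1, by omega⟩) rfl hp rfl
  let U : MvPolynomial (Fin (n + 1)) (MvPolynomial (Fin (n + 1) ⊕ Mon n (n + 1)) ℂ) :=
    moveForm p (fun i => X (Sum.inl i)) (fun m => X (Sum.inr m))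
  have hU (x : Fin (n + 1) → ℂ) (c : Mon n (n + 1) → ℂ) :
      map (eval (Sum.elim x c)) U = moveForm p x c := by
    simp [U, map_moveForm]
  have hev (x : Fin (n + 1) → ℂ) (c : Mon n (n + 1) → ℂ) :
      eval (Sum.elim x c) (X (Sum.inl p) *
        aeval (fun m : {m : Mon n (n + 1) // m.1 p ≠ n + 1} => coeff m.1.1 U) φ) =
      x p * eval (fun m => coeff m.1.1 (moveForm p x c)) φ := by
    rw [map_mul, eval_X, eval_aeval, Sum.elim_inl, ← hU]
    simp only [coeff_map]
  -- The factor `x_p` makes the coordinate change `moveMap p x` injective, so that a contact frame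
  -- can be carried back.
  refine ⟨X (Sum.inl p) * aeval (fun m => coeff m.1.1 U) φ, fun x c h0 hne => ?_, ?_⟩
  · rw [hev] at hne
    have hlink := H (fun m => coeff m.1 (moveForm p x c)) (fun m hm => ?_)
      (right_ne_zero_of_mul hne)
    · rw [formOf_coeff (isHomogeneous_moveForm p x c)] at hlink
      have := hlink.map (moveMap p x) (fun y => eval_moveForm p x y c)
        (ker_moveMap (left_ne_zero_of_mul hne))
      rwa [moveMap_single] at this
    -- The pure-power coefficient at `p` of the moved form is the value of the original form at `x`,
    -- which is zero.
    · have h1 := eval_moveForm p x (Pi.single p 1) c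
      rw [moveMap_single, h0, ← formOf_coeff (isHomogeneous_moveForm p x c),
        eval_single_formOf, one_pow, mul_one] at h1
      rw [eq_single_of_apply_eq hm]
      exact h1
  · obtain ⟨c, hc⟩ : ∃ c, eval c φ ≠ 0 := by
      by_contra! h0
      exact hφ (MvPolynomial.funext fun c => by rw [h0, map_zero])
    let c' : Mon n (n + 1) → ℂ := fun m => if h : m.1 p ≠ n + 1 then c ⟨m, h⟩ else 0
    have hmove : moveForm p (Pi.single p 1) c' = formOf c' := by
      refine MvPolynomial.funext fun y => ?_
      rw [eval_moveForm, moveMap_single_self, LinearMap.id_apply]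
    refine ⟨Pi.single p 1, c', by simp, ?_, ?_⟩
    · rw [eval_single_formOf]
      simp [c', monOf]
    · rw [hev, hmove, Pi.single_eq_same, one_mul]
      convert! hc using 3
      ext m
      rw [coeff_formOf]
      exact dif_pos m.2

end Move

/-! ### The universal hypersurface -/

section Universal

variable {n d : ℕ}

lemma IsLinked.eval_eq_zero {σ : Type} {m : ℕ} {F : MvPolynomial σ ℂ} {p : σ → ℂ}
    (h : IsLinked m F p) : eval p F = 0 := by
  obtain ⟨w, c, α, β, rfl, h⟩ := h
  simpa using h.eval_fst 0 1

lemma IsLinked.form_ne_zero {σ : Type} {m : ℕ} {F : MvPolynomial σ ℂ} {p : σ → ℂ}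
    (h : IsLinked m F p) : F ≠ 0 := by
  rintro rfl
  obtain ⟨w, c, α, β, -, h⟩ := h
  exact h.ne_zero (by simpa using (h.eval_fst 1 1).symm)

lemma RatEquiv.symm {σ : Type} {X : Set (PSpace σ)} {A B : PSpace σ →₀ ℤ} (h : RatEquiv X A B) :
    RatEquiv X B A := by
  have := neg_mem h
  rwa [neg_sub] at this

lemma IsLinked.coeff_ne_zero {m : ℕ} {c : Mon n d → ℂ} {x : Fin (n + 1) → ℂ}
    (h : IsLinked m (formOf c) x) : c ≠ 0 := by
  rintro rfl
  exact h.form_ne_zero (by simp [formOf])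

theorem IsLinked.mem_gLocus {m : ℕ} {c : Mon n d → ℂ} {x : Fin (n + 1) → ℂ}
    (h : IsLinked m (formOf c) x) :
    (Projectivization.mk ℂ x h.ne_zero, Projectivization.mk ℂ c h.coeff_ne_zero) ∈
      GLocus n d := by
  have hF := isHomogeneous_formOf c
  obtain ⟨q, hq, hne, hr⟩ := h.exists_ratEquiv hF
  refine ⟨?_, fun h0 => hne ?_⟩
  · change _ ∈ hypersurface _
    rw [hypersurface_mk]
    exact (vanishesAt_mk_iff hF h.ne_zero).mpr h.eval_eq_zero
  · have : q ∈ ratOrbit (hypersurface (Projectivization.mk ℂ c h.coeff_ne_zero))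
        (Projectivization.mk ℂ x h.ne_zero) := by
      rw [hypersurface_mk]
      exact ⟨hq, 1, one_ne_zero, hr.symm⟩
    exact (Set.ext_iff.mp h0 q).mp this

/-- The parametrization `(x, c, w) ↦ (x, F_w(x) c - F_c(x) w)` of the cone over the universal
hypersurface. -/
def pairParam (n d : ℕ) :
    Fin (n + 1) ⊕ Mon n d → MvPolynomial (Fin (n + 1) ⊕ (Mon n d ⊕ Mon n d)) ℂ :=
  let F (f : Mon n d → Mon n d ⊕ Mon n d) :
      MvPolynomial (Fin (n + 1) ⊕ (Mon n d ⊕ Mon n d)) ℂ :=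
    ∑ m, X (Sum.inr (f m)) * ∏ i, X (Sum.inl i) ^ m.1 i
  Sum.elim (fun i => X (Sum.inl i)) fun m =>
    F Sum.inr * X (Sum.inr (Sum.inl m)) - F Sum.inl * X (Sum.inr (Sum.inr m))

lemma eval_aeval_pairParam (x : Fin (n + 1) → ℂ) (c w : Mon n d → ℂ)
    (H : MvPolynomial (Fin (n + 1) ⊕ Mon n d) ℂ) :
    eval (Sum.elim x (Sum.elim c w)) (aeval (pairParam n d) H) =
      eval (Sum.elim x (eval x (formOf w) • c - eval x (formOf c) • w)) H := by
  rw [eval_aeval]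
  congr 2
  ext (i | m) <;> simp [pairParam, eval_formOf]

lemma eval_formOf_pairParam (x : Fin (n + 1) → ℂ) (c w : Mon n d → ℂ) :
    eval x (formOf (eval x (formOf w) • c - eval x (formOf c) • w)) = 0 := by
  have hsub (a b : ℂ) : formOf (a • c - b • w) = a • formOf c - b • formOf w := by
    simp [formOf, Finset.smul_sum, smul_monomial]
  rw [hsub, map_sub, smul_eval, smul_eval]
  ring

lemma exists_eval_formOf_eq_one {x : Fin (n + 1) → ℂ} (hx : x ≠ 0) :
    ∃ w : Mon n d → ℂ, eval x (formOf w) = 1 := by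
  obtain ⟨j, hj⟩ := Function.ne_iff.mp hx
  refine ⟨Pi.single (monOf (Finsupp.single j d) (by simp)) (x j ^ d)⁻¹, ?_⟩
  rw [eval_formOf, Finset.sum_eq_single (monOf (Finsupp.single j d) (by simp))]
  · rw [Finset.prod_eq_single j]
    · have : x j ≠ 0 := hj
      simp [monOf, this]
    · intro i _ hi
      simp [monOf, Ne.symm hi]
    · simp
  · intro m _ hm
    simp [hm]
  · simp

/-- If `F_c(x) = 0` and `w` is chosen with `F_w(x) = 1`, the parametrization returns `(x, c)`. Thus
polynomials killed by the pullback vanish at every incidence pair with `x ≠ 0`, and the target being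
a domain encodes irreducibility. -/
lemma aeval_pairParam_ne_zero {x : Fin (n + 1) → ℂ} {c : Mon n d → ℂ} (hx : x ≠ 0)
    (hc : eval x (formOf c) = 0) {H : MvPolynomial (Fin (n + 1) ⊕ Mon n d) ℂ}
    (hH : eval (Sum.elim x c) H ≠ 0) : aeval (pairParam n d) H ≠ 0 := by
  obtain ⟨w, hw⟩ := exists_eval_formOf_eq_one (d := d) hx
  intro h0
  have := eval_aeval_pairParam x c w H
  rw [h0, hw, hc, map_zero, one_smul, zero_smul, sub_zero] at this
  exact hH this.symm

theorem not_hasPositiveCodim_gLocus (hn : 3 ≤ n) :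
    ¬ HasPositiveCodim (GLocus n (n + 1)) (universalHypersurface n (n + 1)) := by
  rintro ⟨Z, hZ, hsub⟩
  obtain ⟨Φ, hΦ, x₀, c₀, hx₀, hc₀, hΦ₀⟩ := exists_generic_pair hn
  have key (i : ℕ) : ∃ H, IsBihomogeneous H ∧ (∀ z ∈ Z i, eval (Sum.elim z.1.rep z.2.rep) H = 0) ∧
      aeval (pairParam n (n + 1)) H ≠ 0 := by
    obtain ⟨⟨T, hT, hZT⟩, hU⟩ := hZ i
    obtain ⟨⟨P, b⟩, hPU, hPZ⟩ := Set.not_subset.mp hU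
    rw [hZT, Set.mem_ofPred_eq] at hPZ
    push Not at hPZ
    obtain ⟨H, hH, hne⟩ := hPZ
    refine ⟨H, hT H hH, fun z hz => ?_, aeval_pairParam_ne_zero P.rep_nonzero hPU hne⟩
    rw [hZT] at hz
    exact hz H hH
  choose H hbi hHZ hne using key
  -- Index zero ensures that the pair is linked; index `i + 1` ensures that it avoids `Z i`.
  obtain ⟨y, hy⟩ := exists_forall_eval_ne_zero
    (fun i => Nat.casesOn i (aeval (pairParam n (n + 1)) Φ)
      fun i => aeval (pairParam n (n + 1)) (H i)) (by
        rintro (_ | i)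
        · exact aeval_pairParam_ne_zero hx₀ hc₀ hΦ₀
        · exact hne i)
  obtain ⟨x, c, w, rfl⟩ : ∃ x c w, y = Sum.elim x (Sum.elim c w) :=
    ⟨fun i => y (Sum.inl i), fun m => y (Sum.inr (Sum.inl m)), fun m => y (Sum.inr (Sum.inr m)), by
      ext (i | i | i) <;> rfl⟩
  have h0 : eval _ (aeval (pairParam n (n + 1)) Φ) ≠ 0 := hy 0
  rw [eval_aeval_pairParam] at h0
  have hlink := hΦ x _ (eval_formOf_pairParam x c w) h0
  obtain ⟨i, hi⟩ := Set.mem_iUnion.mp (hsub hlink.mem_gLocus)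
  have hv := hHZ i _ hi
  obtain ⟨a, ha⟩ := Projectivization.exists_smul_eq_mk_rep ℂ _ hlink.ne_zero
  obtain ⟨b, hb⟩ := Projectivization.exists_smul_eq_mk_rep ℂ _ hlink.coeff_ne_zero
  rw [← ha, ← hb, Units.smul_def, Units.smul_def,
    (hbi i).eval_smul_eq_zero_iff a.ne_zero b.ne_zero] at hv
  have h1 : eval _ (aeval (pairParam n (n + 1)) (H i)) ≠ 0 := hy (i + 1)
  rw [eval_aeval_pairParam] at h1
  exact h1 hv

end Universal

/-! ### Eliminating a coordinate -/

section Elimination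

variable {n d : ℕ}

/-- The components of `G` at `v` are the coefficients of the one-variable polynomial `s ↦ G(s v)`.
This allows inhomogeneous polynomials to cut out closed sets through their components. -/
lemma exists_smul_eval_ne_zero {σ : Type} {G : MvPolynomial σ ℂ} {v : σ → ℂ} {k : ℕ}
    (h : eval v (homogeneousComponent k G) ≠ 0) : ∃ s : ℂ, s ≠ 0 ∧ eval (s • v) G ≠ 0 := by
  by_contra! h0
  set P : Polynomial ℂ := ∑ i ∈ Finset.range (G.totalDegree + 1),
    Polynomial.monomial i (eval v (homogeneousComponent i G)) with hP
  have hev (s : ℂ) : P.eval s = eval (s • v) G := by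
    conv_rhs => rw [← sum_homogeneousComponent G]
    rw [hP, Polynomial.eval_finsetSum, map_sum]
    refine Finset.sum_congr rfl fun i _ => ?_
    rw [eval_smul_of_isHomogeneous (homogeneousComponent_isHomogeneous i G),
      Polynomial.eval_monomial, mul_comm]
  have hP0 : P = 0 := by
    refine Polynomial.eq_zero_of_infinite_isRoot _ ((Set.finite_singleton (0 : ℂ)).infinite_compl.mono
      fun s hs => ?_)
    exact (hev s).trans (h0 s hs)
  by_cases hk : k < G.totalDegree + 1
  · have := congrArg (fun Q => Q.coeff k) hP0
    simp only [hP, Polynomial.finsetSum_coeff, Polynomial.coeff_monomial, Polynomial.coeff_zero,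
      Finset.sum_ite_eq', Finset.mem_range, hk, if_true] at this
    exact h this
  · rw [homogeneousComponent_eq_zero _ _ (by omega), map_zero] at h
    exact h rfl

lemma eval_eq_zero_of_forall_homogeneousComponent {σ : Type} {G : MvPolynomial σ ℂ} {v : σ → ℂ}
    (h : ∀ k, eval v (homogeneousComponent k G) = 0) : eval v G = 0 := by
  rw [← sum_homogeneousComponent G, map_sum]
  exact Finset.sum_eq_zero fun i _ => h i

/-- The coefficient of the universal form at the pure power of the `0`-th coordinate. -/
def headMon (n d : ℕ) : Mon n d := monOf (Finsupp.single 0 d) (by simp)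

/-- The inclusion of the polynomials that do not involve the `0`-th coordinate. -/
def tailIncl (n d : ℕ) :
    MvPolynomial (Fin n ⊕ Mon n d) ℂ →ₐ[ℂ] MvPolynomial (Fin (n + 1) ⊕ Mon n d) ℂ :=
  rename (Sum.map Fin.succ id)

lemma eval_tailIncl (x : Fin (n + 1) → ℂ) (c : Mon n d → ℂ)
    (r : MvPolynomial (Fin n ⊕ Mon n d) ℂ) :
    eval (Sum.elim x c) (tailIncl n d r) = eval (Sum.elim (fun i => x i.succ) c) r := by
  rw [tailIncl, eval_rename]
  congr 2
  ext (i | m) <;> rfl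

/-- The universal form as a polynomial in the `0`-th coordinate. -/
def headPoly (n d : ℕ) : Polynomial (MvPolynomial (Fin n ⊕ Mon n d) ℂ) :=
  ∑ m, Polynomial.monomial (m.1 0) (X (Sum.inr m) * ∏ i : Fin n, X (Sum.inl i) ^ m.1 i.succ)

lemma headPoly_ne_zero : headPoly n d ≠ 0 := by
  classical
  intro h
  have h1 := congrArg (Polynomial.map
    (eval (Sum.elim (0 : Fin n → ℂ) (Pi.single (headMon n d) (1 : ℂ))))) h
  rw [headPoly, Polynomial.map_sum, Finset.sum_eq_single (headMon n d)] at h1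
  · simp [headMon, monOf] at h1
  · intro m _ hm
    simp [hm]
  · simp

/-- If the images of the variables are algebraic over a subring, every element with nonzero image
divides a nonzero element of the subring modulo the kernel. -/
lemma exists_relation_of_forall_X {A D σ : Type*} [CommRing A] [IsDomain A] [CommRing D] [IsDomain D]
    (e : A →+* MvPolynomial σ ℂ) (g : MvPolynomial σ ℂ →+* D) (hC : ∀ z, ∃ a, e a = C z)
    (hX : ∀ i, ∃ P : Polynomial A, P ≠ 0 ∧ g (P.eval₂ e (X i)) = 0) {Φ : MvPolynomial σ ℂ}
    (hΦ : g Φ ≠ 0) : ∃ q : Polynomial A, q.coeff 0 ≠ 0 ∧ g (q.eval₂ e Φ) = 0 := by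
  let _ : Algebra A D := (g.comp e).toAlgebra
  have hq (q : Polynomial A) (Ψ : MvPolynomial σ ℂ) :
      Polynomial.aeval (g Ψ) q = g (q.eval₂ e Ψ) := (Polynomial.hom_eval₂ q e g Ψ).symm
  have halg (F : MvPolynomial σ ℂ) : IsAlgebraic A (g F) := by
    induction F using MvPolynomial.induction_on with
    | C z =>
      obtain ⟨a, ha⟩ := hC z
      rw [← ha]
      exact isAlgebraic_algebraMap a
    | add F G hF hG => rw [map_add]; exact hF.add hG
    | mul_X F i hF =>
      obtain ⟨P, hP, h0⟩ := hX i
      rw [map_mul]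
      exact hF.mul ⟨P, hP, by rw [hq, h0]⟩
  -- Since `g Φ` is not a zero divisor, powers of it cancel from a relation until the constant term
  -- is nonzero.
  obtain ⟨q, hq0, hqr⟩ := (halg Φ).exists_nonzero_coeff_and_aeval_eq_zero
    (mem_nonZeroDivisors_of_ne_zero hΦ)
  exact ⟨q, hq0, by rw [← hq, hqr]⟩

lemma eval_headPoly (x : Fin (n + 1) → ℂ) (c : Mon n d → ℂ) :
    eval (Sum.elim x c) ((headPoly n d).eval₂ (tailIncl n d : _ →+* _) (X (Sum.inl 0))) =
      eval x (formOf c) := by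
  rw [eval_formOf, headPoly, Polynomial.eval₂_finsetSum, map_sum]
  refine Finset.sum_congr rfl fun m _ => ?_
  rw [Polynomial.eval₂_monomial, map_mul, RingHom.coe_coe, eval_tailIncl, Fin.prod_univ_succ]
  simp only [map_mul, map_prod, map_pow, eval_X, Sum.elim_inl, Sum.elim_inr]
  ring

lemma exists_relation {Φ : MvPolynomial (Fin (n + 1) ⊕ Mon n d) ℂ}
    (hΦ : aeval (pairParam n d) Φ ≠ 0) :
    ∃ q : Polynomial (MvPolynomial (Fin n ⊕ Mon n d) ℂ), q.coeff 0 ≠ 0 ∧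
      aeval (pairParam n d) (q.eval₂ (tailIncl n d : _ →+* _) Φ) = 0 := by
  let e : MvPolynomial (Fin n ⊕ Mon n d) ℂ →+* MvPolynomial (Fin (n + 1) ⊕ Mon n d) ℂ :=
    tailIncl n d
  let g : MvPolynomial (Fin (n + 1) ⊕ Mon n d) ℂ →+*
      MvPolynomial (Fin (n + 1) ⊕ (Mon n d ⊕ Mon n d)) ℂ := aeval (R := ℂ) (pairParam n d)
  have hC (z : ℂ) : ∃ a, e a = C z := ⟨C z, by simp [e, tailIncl]⟩
  have hX' (j) : ∃ P : Polynomial (MvPolynomial (Fin n ⊕ Mon n d) ℂ), P ≠ 0 ∧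
      g (P.eval₂ e (X (Sum.map Fin.succ id j))) = 0 := by
    refine ⟨Polynomial.X - Polynomial.C (X j), Polynomial.X_sub_C_ne_zero _, ?_⟩
    rw [Polynomial.eval₂_sub, Polynomial.eval₂_X, Polynomial.eval₂_C]
    simp [e, tailIncl]
  have hX (i) : ∃ P : Polynomial (MvPolynomial (Fin n ⊕ Mon n d) ℂ), P ≠ 0 ∧
      g (P.eval₂ e (X i)) = 0 := by
    obtain (i | m) := i
    · induction i using Fin.cases with
      | succ i => exact hX' (Sum.inl i)
      | zero =>
        -- On the incidence, the universal equation itself makes `x_0` algebraic over the other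
        -- variables.
        refine ⟨headPoly n d, headPoly_ne_zero, MvPolynomial.funext fun y => ?_⟩
        obtain ⟨x, c, w, rfl⟩ : ∃ x c w, y = Sum.elim x (Sum.elim c w) :=
          ⟨fun i => y (Sum.inl i), fun m => y (Sum.inr (Sum.inl m)),
            fun m => y (Sum.inr (Sum.inr m)), by ext (i | i | i) <;> rfl⟩
        refine (eval_aeval_pairParam _ _ _ _).trans ?_
        rw [eval_headPoly, eval_formOf_pairParam, map_zero]
    · exact hX' (Sum.inr m)
  obtain ⟨q, h1, h2⟩ := exists_relation_of_forall_X e g hC hX (Φ := Φ) hΦ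
  exact ⟨q, h1, h2⟩

lemma exists_elimination {Φ : MvPolynomial (Fin (n + 1) ⊕ Mon n d) ℂ} {x₀ : Fin (n + 1) → ℂ}
    {c₀ : Mon n d → ℂ} (hx₀ : x₀ ≠ 0) (hc₀ : eval x₀ (formOf c₀) = 0)
    (hΦ : eval (Sum.elim x₀ c₀) Φ ≠ 0) :
    ∃ r : MvPolynomial (Fin n ⊕ Mon n d) ℂ, r ≠ 0 ∧
      ∀ x c, x ≠ 0 → eval x (formOf c) = 0 → eval (Sum.elim (fun i => x i.succ) c) r ≠ 0 →
        eval (Sum.elim x c) Φ ≠ 0 := by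
  obtain ⟨q, hq0, hq⟩ := exists_relation (aeval_pairParam_ne_zero hx₀ hc₀ hΦ)
  -- If `Φ` vanished at an incidence pair, the relation evaluated there would reduce to its constant
  -- term, which is nonzero, whereas the relation holds on the whole incidence.
  refine ⟨q.coeff 0, hq0, fun x c hx hc hne h0 => ?_⟩
  refine aeval_pairParam_ne_zero hx hc ?_ hq
  rw [Polynomial.hom_eval₂, h0, Polynomial.eval₂_at_zero, RingHom.comp_apply, RingHom.coe_coe,
    eval_tailIncl]
  exact hne

/-- A form is monic in the `0`-th coordinate if the coefficient of the pure power is one. -/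
lemma monic_finSuccEquiv_formOf {c : Mon n d → ℂ} (hc : c (headMon n d) = 1) :
    (finSuccEquiv ℂ n (formOf c)).Monic := by
  have hF := isHomogeneous_formOf c
  refine Polynomial.monic_of_natDegree_le_of_coeff_eq_one d ?_ ?_
  · rw [natDegree_finSuccEquiv]
    exact (degreeOf_le_totalDegree _ _).trans hF.totalDegree_le
  · ext m
    rw [finSuccEquiv_coeff_coeff, coeff_one]
    split_ifs with hm
    · rw [← hm, Finsupp.cons_zero_eq_single_zero, ← hc]
      exact coeff_formOf c (headMon n d)
    · refine hF.coeff_eq_zero fun hdeg => hm ?_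
      rw [Finsupp.degree_eq_sum, Fin.sum_univ_succ, Finsupp.cons_zero, Nat.add_eq_left] at hdeg
      ext i
      simpa using (Finset.sum_eq_zero_iff.mp hdeg i (Finset.mem_univ i)).symm

/-- A hypersurface on which the `0`-th coordinate is finite over the other ones has no component
on which a nonzero polynomial in the other coordinates vanishes. -/
theorem eval_eq_zero_of_forall_mul_eq_zero {c : Mon n d → ℂ} (hc : c (headMon n d) ≠ 0)
    {R : MvPolynomial (Fin n) ℂ} (hR : R ≠ 0) {H : MvPolynomial (Fin (n + 1)) ℂ}
    (h : ∀ x, eval x (formOf c) = 0 → eval (fun i => x i.succ) R * eval x H = 0)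
    {x : Fin (n + 1) → ℂ} (hx : eval x (formOf c) = 0) : eval x H = 0 := by
  wlog h1 : c (headMon n d) = 1 generalizing c
  · have hs (y) : eval y (formOf ((c (headMon n d))⁻¹ • c)) = 0 ↔ eval y (formOf c) = 0 := by
      rw [formOf_smul, smul_eval]
      simp [hc]
    refine this (c := (c (headMon n d))⁻¹ • c) ?_ (fun y hy => h y ((hs y).mp hy)) ((hs x).mpr hx) ?_
    · simp [hc]
    · simp [hc]
  -- By the Nullstellensatz the form divides a power of `R H`. The form is monic in `x_0`, so the
  -- quotient by it is free over the polynomials in the other variables, and the factor `R ^ N`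
  -- cancels.
  have hmem : rename Fin.succ R * H ∈ (Ideal.span {formOf c}).radical := by
    rw [← vanishingIdeal_zeroLocus_eq_radical (K := ℂ)]
    intro y hy
    have := h y (hy _ (Ideal.mem_span_singleton_self _))
    simpa [eval_rename, Function.comp_def] using this
  obtain ⟨N, hN⟩ := hmem
  rw [Ideal.mem_span_singleton, mul_pow] at hN
  have hmon := monic_finSuccEquiv_formOf h1
  have hdvd := map_dvd (finSuccEquiv ℂ n) hN
  have hren : finSuccEquiv ℂ n (rename Fin.succ R) = Polynomial.C R := by
    have : (finSuccEquiv ℂ n).toAlgHom.comp (rename Fin.succ) = Polynomial.CAlgHom :=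
      MvPolynomial.algHom_ext fun i => by simpa using finSuccEquiv_X_succ
    exact DFunLike.congr_fun this R
  rw [map_mul, map_pow, hren, ← Polynomial.C_pow, ← Polynomial.smul_eq_C_mul,
    ← Polynomial.modByMonic_eq_zero_iff_dvd hmon, Polynomial.smul_modByMonic,
    smul_eq_zero_iff_right (pow_ne_zero _ hR), Polynomial.modByMonic_eq_zero_iff_dvd hmon] at hdvd
  have hdvd' : formOf c ∣ H ^ N := by
    simpa using map_dvd (finSuccEquiv ℂ n).symm hdvd
  obtain ⟨Q, hQ⟩ := hdvd'
  have := congrArg (eval x) hQ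
  rw [map_mul, hx, zero_mul, map_pow] at this
  exact eq_zero_of_pow_eq_zero this

end Elimination

/-! ### Very general hypersurfaces -/

section VeryGeneral

variable {n d : ℕ}

lemma isZariskiClosed_homogeneousComponents {σ : Type} (S : Set (MvPolynomial σ ℂ)) :
    IsZariskiClosed {p : PSpace σ | ∀ G ∈ S, ∀ k, VanishesAt (homogeneousComponent k G) p} := by
  refine ⟨{F | ∃ G ∈ S, ∃ k, F = homogeneousComponent k G}, ?_, ?_⟩
  · rintro _ ⟨G, -, k, rfl⟩
    exact ⟨k, homogeneousComponent_isHomogeneous k G⟩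
  · ext p
    constructor
    · rintro h _ ⟨G, hG, k, rfl⟩
      exact h G hG k
    · exact fun h G hG k => h _ ⟨G, hG, k, rfl⟩

lemma mk_smul_rep {σ : Type} (p : PSpace σ) {s : ℂ} (h : s • p.rep ≠ 0) :
    Projectivization.mk ℂ (s • p.rep) h = p := by
  conv_rhs => rw [← p.mk_rep]
  exact (Projectivization.mk_eq_mk_iff' ℂ _ _ _ _).mpr ⟨s, rfl⟩

/-- The scalar `t` is needed because `r` need not be homogeneous in the coefficients; replacing
`b.rep` by a multiple does not change the hypersurface. -/
theorem forGeneralPointOf_hypersurface {m : ℕ} {r : MvPolynomial (Fin n ⊕ Mon n d) ℂ}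
    (h0 : ∀ c, eval (Sum.elim 0 c) r = 0)
    (hr : ∀ x c, x ≠ 0 → eval x (formOf c) = 0 → eval (Sum.elim (fun i => x i.succ) c) r ≠ 0 →
        IsLinked m (formOf c) x)
    {b : PSpace (Mon n d)} {t : ℂ} (ht : (t • b.rep) (headMon n d) ≠ 0) {y : Fin n → ℂ}
    (hy : eval (Sum.elim y (t • b.rep)) r ≠ 0) :
    ForGeneralPointOf (hypersurface b) (fun p => ∃ q ∈ hypersurface b, q ≠ p ∧
      RatEquiv (hypersurface b) (Finsupp.single p 1) (Finsupp.single q 1)) := by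
  set c := t • b.rep with hc
  have hc0 : c ≠ 0 := fun h => ht (congrFun h _)
  have hX : hypersurface b = {P | VanishesAt (formOf c) P} := by
    rw [← hypersurface_mk hc0, mk_smul_rep]
  rw [hX]
  have hF := isHomogeneous_formOf c
  let R : MvPolynomial (Fin n) ℂ := aeval (Sum.elim X fun k => C (c k)) r
  have hevR (z : Fin n → ℂ) : eval z R = eval (Sum.elim z c) r := by
    rw [eval_aeval]
    congr 2
    ext (i | k) <;> simp
  have hR : R ≠ 0 := fun h => hy (by rw [← hevR, h, map_zero])
  have hevS (x : Fin (n + 1) → ℂ) :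
      eval x (rename Fin.succ R) = eval (Sum.elim (fun i => x i.succ) c) r := by
    rw [eval_rename, hevR]
    rfl
  refine ⟨_, isZariskiClosed_homogeneousComponents {rename Fin.succ R}, ?_, ?_⟩
  · rintro _ ⟨T, hT, rfl⟩ hsub P hP H hH
    obtain ⟨k, hk⟩ := hT H hH
    refine eval_eq_zero_of_forall_mul_eq_zero ht hR (fun x hx => ?_) hP
    by_contra hne
    rw [hevR] at hne
    have hxr := left_ne_zero_of_mul hne
    -- The density argument runs on the affine cone, and `h0` discards its vertex, which is not a
    -- projective point.
    have hx0 : x ≠ 0 := by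
      rintro rfl
      exact hxr (h0 c)
    have hmem : Projectivization.mk ℂ x hx0 ∈ {p | ∀ F ∈ T, VanishesAt F p} := by
      refine hsub ⟨(vanishesAt_mk_iff hF hx0).mpr hx, fun hZ => hxr ?_⟩
      rw [← hevS]
      refine eval_eq_zero_of_forall_homogeneousComponent fun j => ?_
      exact (vanishesAt_mk_iff (homogeneousComponent_isHomogeneous j _) hx0).mp (hZ _ rfl j)
    exact right_ne_zero_of_mul hne ((vanishesAt_mk_iff hk hx0).mp (hmem H hH))
  · rintro P ⟨hP, hPZ⟩
    rw [Set.mem_ofPred_eq] at hPZ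
    push Not at hPZ
    obtain ⟨G, rfl, k, hk⟩ := hPZ
    obtain ⟨s, hs, hne⟩ := exists_smul_eval_ne_zero hk
    rw [hevS] at hne
    have hlink := hr _ c (smul_ne_zero hs P.rep_nonzero) (by
      rw [eval_smul_of_isHomogeneous hF, show eval P.rep (formOf c) = 0 from hP, mul_zero]) hne
    have := hlink.exists_ratEquiv hF
    rwa [mk_smul_rep] at this

theorem forVeryGeneral_hypersurface (hn : 3 ≤ n) :
    ForVeryGeneral (fun b : PSpace (Mon n (n + 1)) => ForGeneralPointOf (hypersurface b)
      (fun p => ∃ q ∈ hypersurface b, q ≠ p ∧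
        RatEquiv (hypersurface b) (Finsupp.single p 1) (Finsupp.single q 1))) := by
  obtain ⟨Φ, hΦ, x₀, c₀, hx₀, hc₀, hΦ₀⟩ := exists_generic_pair hn
  obtain ⟨r, hr, hrΦ⟩ := exists_elimination hx₀ hc₀ hΦ₀
  let i₀ : Fin n := ⟨0, by omega⟩
  -- One extra factor forces vanishing at the vertex of the cone, the other makes the form of exact
  -- degree `n + 1` in `x_0`.
  let r' := r * X (Sum.inl i₀) * X (Sum.inr (headMon n (n + 1)))
  have hev (y c) : eval (Sum.elim y c) r' =
      eval (Sum.elim y c) r * y i₀ * c (headMon n (n + 1)) := by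
    simp [r']
  let S : Set (MvPolynomial (Mon n (n + 1)) ℂ) :=
    {G | ∃ y : Fin n → ℂ, G = aeval (Sum.elim (fun i => C (y i)) X) r'}
  have hevS (y c) : eval c (aeval (Sum.elim (fun i => C (y i)) X) r') =
      eval (Sum.elim y c) r' := by
    rw [eval_aeval]
    congr 2
    ext (i | k) <;> simp
  -- A single proper closed set suffices, so the countable family is constant.
  refine ⟨fun _ => _, fun _ => ⟨isZariskiClosed_homogeneousComponents S, fun huniv => ?_⟩,
    fun b hb => ?_⟩
  · obtain ⟨z, hz⟩ : ∃ z, eval z r' ≠ 0 := by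
      by_contra! h0
      refine mul_ne_zero (mul_ne_zero hr (X_ne_zero _)) (X_ne_zero _)
        (MvPolynomial.funext fun z => ?_ : r' = 0)
      rw [h0, map_zero]
    obtain ⟨y, c, rfl⟩ : ∃ y c, z = Sum.elim y c :=
      ⟨fun i => z (Sum.inl i), fun m => z (Sum.inr m), by ext (i | i) <;> rfl⟩
    have hc : c ≠ 0 := by
      rintro rfl
      exact hz (by simp [hev])
    have hmem := Set.eq_univ_iff_forall.mp huniv (Projectivization.mk ℂ c hc)
    refine hz ?_
    rw [← hevS]
    refine eval_eq_zero_of_forall_homogeneousComponent fun j => ?_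
    exact (vanishesAt_mk_iff (homogeneousComponent_isHomogeneous j _) hc).mp (hmem _ ⟨y, rfl⟩ j)
  · have hb0 := hb 0
    rw [Set.mem_ofPred_eq] at hb0
    push Not at hb0
    obtain ⟨_, ⟨y, rfl⟩, k, hk⟩ := hb0
    obtain ⟨t, -, hne⟩ := exists_smul_eval_ne_zero hk
    rw [hevS] at hne
    refine forGeneralPointOf_hypersurface (m := n) (r := r') (fun c => by simp [hev])
      (fun x c hx hc h => hΦ x c hc (hrΦ x c hx hc ?_)) (t := t) ?_ hne
    · rw [hev] at h
      exact left_ne_zero_of_mul (left_ne_zero_of_mul h)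
    · rw [hev] at hne
      exact right_ne_zero_of_mul hne

end VeryGeneral

end ChowPoints

end

theorem mainTheorem10 (n : ℕ) (hn : 3 ≤ n) :
    ChowPoints.ForVeryGeneral (fun b : ChowPoints.PSpace (ChowPoints.Mon n (n + 1)) =>
      ChowPoints.ForGeneralPointOf (ChowPoints.hypersurface b) (fun p =>
        ∃ q ∈ ChowPoints.hypersurface b, q ≠ p ∧
          ChowPoints.RatEquiv (ChowPoints.hypersurface b)
            (Finsupp.single p 1) (Finsupp.single q 1))) ∧
    ¬ ChowPoints.HasPositiveCodim (ChowPoints.GLocus n (n + 1))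
        (ChowPoints.universalHypersurface n (n + 1)) :=
  ⟨ChowPoints.forVeryGeneral_hypersurface hn, ChowPoints.not_hasPositiveCodim_gLocus hn⟩
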